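/- **Conventions.** All graphs are finite, undirected and without loops or multiple edges, and a graph is *cubic* if every vertex has degree 3. A *3-edge-colouring* of a graph assigns to each edge one of three given colours so that adjacent edges get different colours. A graph $G$ is *cyclically $k$-edge-connected* if for any two vertex-disjoint cycles $A$, $B$ of $G$ there is no set $S$ of fewer than $k$ edges of $G$ such that $A$ and $B$ lie entirely in different components of $G-S$ (the graph obtained from $G$ by deleting the edges in $S$). A *snark* is a connected cubic graph of girth at least 5 that is cyclically 4-edge-connected and has no 3-edge-colouring. Let $e=(u,v)$ be an edge of a snark $G$, let $u_1,u_2$ be the neighbours of $u$ other than $v$, and let $v_1,v_2$ be the neighbours of $v$ other than $u$. The *edge-subtracted graph* $G_e$ is obtained from $G$ by deleting $u$ and $v$ together with all edges at them and adding the new edges $(u_1,u_2)$ and $(v_1,v_2)$. Put $$\psi(G,e)=\frac{\#\{\text{3-edge-colourings of } G_e\}}{18}.$$ **Theorem 5.5.** For all nonnegative integers $i,j$ there exist a cyclically 5-edge-connected snark $G$ and an edge $e$ of $G$ such that $\psi(G,e)=5^i\cdot 7^j$. -/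

import Mathlib

namespace SimpleGraph

variable {V : Type*}

/-- The 3-edge-colourings of `G`: each edge receives one of three colours, and edges that share an
endpoint receive different colours. -/
abbrev ThreeEdgeColouring (G : SimpleGraph V) : Type _ :=
  G.lineGraph.Coloring (Fin 3)

/-- `G` is cyclically `k`-edge-connected: two vertex-disjoint cycles never lie entirely in different
components of the graph `G - S` left by deleting a set `S` of fewer than `k` edges. That the cycle
`p` lies entirely in one component of `G - S` means that `S` contains no edge of `p`; the
component is then that of any of its vertices. -/
def CyclicallyEdgeConnected (G : SimpleGraph V) (k : ℕ) : Prop :=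
  ∀ ⦃a b : V⦄ (p : G.Walk a a) (q : G.Walk b b), p.IsCycle → q.IsCycle →
    p.support.Disjoint q.support →
    ∀ S : Finset (Sym2 V), (S : Set (Sym2 V)) ⊆ G.edgeSet → S.card < k →
      (∀ d ∈ p.edges, d ∉ S) → (∀ d ∈ q.edges, d ∉ S) →
      (G.deleteEdges (S : Set (Sym2 V))).Reachable a b

/-- Snarks: finite connected cubic graphs (without loops or multiple edges) of girth at least 5
that are cyclically 4-edge-connected and have no 3-edge-colouring. -/
structure IsSnark (G : SimpleGraph V) : Prop where
  finite : Finite V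
  connected : G.Connected
  cubic : ∀ v : V, (G.neighborSet v).ncard = 3
  girth : 5 ≤ G.egirth
  cyclically : G.CyclicallyEdgeConnected 4
  uncolourable : IsEmpty G.ThreeEdgeColouring

/-- The edge-subtracted graph `G_e`: both endpoints of `e` are deleted, with all edges at them, and
for each endpoint `w` of `e` the neighbours of `w` that remain are joined by a new edge. In a cubic
graph these are exactly two vertices for each `w`. In a graph of girth at least 5 the two new edges
are distinct and are not already present, so that `G_e` has no multiple edges. -/
def edgeSubtract (G : SimpleGraph V) (e : Sym2 V) : SimpleGraph {x : V // x ∉ e} where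
  Adj x y := x ≠ y ∧ (G.Adj x y ∨ ∃ w ∈ e, G.Adj w x ∧ G.Adj w y)
  symm := ⟨fun _ _ h => ⟨h.1.symm, h.2.imp (fun k => k.symm)
    (fun ⟨w, hw, h₁, h₂⟩ => ⟨w, hw, h₂, h₁⟩)⟩⟩
  loopless := ⟨fun _ h => h.1 rfl⟩

/-- `ψ(G, e)`: the number of 3-edge-colourings of `G_e`, divided by 18. The division is exact
division of rational numbers, not truncated division. -/
noncomputable def psi (G : SimpleGraph V) (e : Sym2 V) : ℚ :=
  (Nat.card (G.edgeSubtract e).ThreeEdgeColouring : ℚ) / 18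

end SimpleGraph

/-! The snark is a chain of multipoles, open cubic pieces joined along five semiedges at a time. For
colourings a piece acts as a transfer matrix on functions of the colours of five semiedges
(`count_glue`).

The chain starts with a pentagon. Its semiedges extend to a colouring only if three have one colour
and the other two have the remaining colours and sit at neighbouring vertices. Numbering the
semiedges with steps of two gives the indicator `pentagramWeight`. Closing this piece with a
pentagon in cyclic order produces the Petersen graph: the two pentagons demand the two isolated
colours at cyclic distance two and one respectively, so no colouring exists. Subtracting an edge of
the closing pentagon leaves 18 colourings, hence `ψ = 1`.

Between the two pentagons any number of links can be inserted. `fivefold` and `sevenfold` have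
`pentagramWeight` as an eigenvector, with eigenvalues 5 and 7. So `i` and `j` copies of them
multiply the number of colourings after subtraction by `5 ^ i * 7 ^ j`, while the closed graph stays
uncolourable, `0` being multiplied as well.

Cyclic 5-edge-connectivity passes along the chain as an expansion property: a nonempty set of `s`
vertices has boundary at least `min 5 (s + 2)`. Here `s + 2` is the boundary of a tree on `s`
vertices in a cubic graph. The property survives gluing (`expand_glue`, `expand_close`) if each link
has no cut of fewer than five edges between its two ends and no short cycle arises at the seam. In
the closed graph it gives connectedness, girth at least 5 and cyclic 5-edge-connectivity. The facts
about the individual pieces are finite searches, carried out by programs proved correct in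
`cutSearch_sound` and `colourSearch_eq`. -/

/-! ### Multipoles, gluing and the composition of colouring counts -/

/-- A multipole: edges `E` with endpoints `src` and `tgt` among the vertices `V`, and semiedges `ι`,
the semiedge `i` being attached to the vertex `out i`. -/
structure Pole (V E ι : Type) where
  src : E → V
  tgt : E → V
  out : ι → V

namespace Pole

variable {V W E F ι κ : Type}

/-- Incidence of edges and semiedges with vertices. -/
def Inc (P : Pole V E ι) : E ⊕ ι → V → Prop
  | Sum.inl e, v => P.src e = v ∨ P.tgt e = v
  | Sum.inr i, v => P.out i = v

/-- Edges and semiedges that share a vertex have different colours. -/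
def Proper (P : Pole V E ι) (c : E ⊕ ι → Fin 3) : Prop :=
  ∀ p q v, P.Inc p v → P.Inc q v → c p = c q → p = q

/-- The number of proper colourings in which the semiedges have the colours `b`. -/
noncomputable def count (P : Pole V E ι) (b : ι → Fin 3) : ℕ :=
  Nat.card {φ : E → Fin 3 // P.Proper (Sum.elim φ b)}

/-- Join the semiedges of `P` to the semiedges of `Q` in the first summand. -/
def glue (P : Pole V E ι) (Q : Pole W F (ι ⊕ κ)) : Pole (V ⊕ W) (E ⊕ ι ⊕ F) κ where
  src := Sum.elim (Sum.inl ∘ P.src) (Sum.elim (Sum.inl ∘ P.out) (Sum.inr ∘ Q.src))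
  tgt := Sum.elim (Sum.inl ∘ P.tgt) (Sum.elim (Sum.inr ∘ Q.out ∘ Sum.inl) (Sum.inr ∘ Q.tgt))
  out := Sum.inr ∘ Q.out ∘ Sum.inr

/-- The edges and semiedges of the first part, as edges of the glued multipole. -/
def glueLeft : E ⊕ ι → (E ⊕ ι ⊕ F) ⊕ κ
  | Sum.inl e => Sum.inl (Sum.inl e)
  | Sum.inr i => Sum.inl (Sum.inr (Sum.inl i))

/-- The edges and semiedges of the second part, as edges and semiedges of the glued multipole. -/
def glueRight : F ⊕ (ι ⊕ κ) → (E ⊕ ι ⊕ F) ⊕ κ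
  | Sum.inl f => Sum.inl (Sum.inr (Sum.inr f))
  | Sum.inr (Sum.inl i) => Sum.inl (Sum.inr (Sum.inl i))
  | Sum.inr (Sum.inr k) => Sum.inr k

theorem glueLeft_injective : Function.Injective (glueLeft : E ⊕ ι → (E ⊕ ι ⊕ F) ⊕ κ) := by
  rintro (e | i) (e' | i') h <;> simp_all [glueLeft]

theorem glueRight_injective : Function.Injective (glueRight : F ⊕ (ι ⊕ κ) → (E ⊕ ι ⊕ F) ⊕ κ) := by
  rintro (e | i | k) (e' | i' | k') h <;> simp_all [glueRight]

theorem inc_glue_inl (P : Pole V E ι) (Q : Pole W F (ι ⊕ κ)) (p : (E ⊕ ι ⊕ F) ⊕ κ) (v : V) :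
    (P.glue Q).Inc p (Sum.inl v) ↔ ∃ p', glueLeft p' = p ∧ P.Inc p' v := by
  rcases p with (e | i | f) | k <;> simp [Inc, glue, glueLeft]

theorem inc_glue_inr (P : Pole V E ι) (Q : Pole W F (ι ⊕ κ)) (p : (E ⊕ ι ⊕ F) ⊕ κ) (w : W) :
    (P.glue Q).Inc p (Sum.inr w) ↔ ∃ p', glueRight p' = p ∧ Q.Inc p' w := by
  rcases p with (e | i | f) | k <;> simp [Inc, glue, glueRight]

/-- Properness is a condition at each vertex, and every vertex of the glued multipole keeps the
incidences it had in its own part. -/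
theorem proper_glue (P : Pole V E ι) (Q : Pole W F (ι ⊕ κ)) (c : (E ⊕ ι ⊕ F) ⊕ κ → Fin 3) :
    (P.glue Q).Proper c ↔ P.Proper (c ∘ glueLeft) ∧ Q.Proper (c ∘ glueRight) := by
  constructor
  · intro h
    refine ⟨fun p q v hp hq hc => ?_, fun p q w hp hq hc => ?_⟩
    · exact glueLeft_injective (h _ _ (Sum.inl v) ((inc_glue_inl P Q _ _).2 ⟨p, rfl, hp⟩)
        ((inc_glue_inl P Q _ _).2 ⟨q, rfl, hq⟩) hc)
    · exact glueRight_injective (h _ _ (Sum.inr w) ((inc_glue_inr P Q _ _).2 ⟨p, rfl, hp⟩)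
        ((inc_glue_inr P Q _ _).2 ⟨q, rfl, hq⟩) hc)
  · rintro ⟨hP, hQ⟩ p q (v | w) hp hq hc
    · obtain ⟨p, rfl, hp'⟩ := (inc_glue_inl P Q _ _).1 hp
      obtain ⟨q, rfl, hq'⟩ := (inc_glue_inl P Q _ _).1 hq
      rw [hP p q v hp' hq' hc]
    · obtain ⟨p, rfl, hp'⟩ := (inc_glue_inr P Q _ _).1 hp
      obtain ⟨q, rfl, hq'⟩ := (inc_glue_inr P Q _ _).1 hq
      rw [hQ p q w hp' hq' hc]

theorem elim_comp_glueLeft (φ : E ⊕ ι ⊕ F → Fin 3) (b : κ → Fin 3) :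
    Sum.elim φ b ∘ glueLeft = Sum.elim (φ ∘ Sum.inl) (φ ∘ Sum.inr ∘ Sum.inl) := by
  ext (e | i) <;> rfl

theorem elim_comp_glueRight (φ : E ⊕ ι ⊕ F → Fin 3) (b : κ → Fin 3) :
    Sum.elim φ b ∘ glueRight =
      Sum.elim (φ ∘ Sum.inr ∘ Sum.inr) (Sum.elim (φ ∘ Sum.inr ∘ Sum.inl) b) := by
  ext (e | i | k) <;> rfl

/-- A colouring of a glued multipole is a pair of colourings that agree on the joined semiedges. -/
def glueColouring (P : Pole V E ι) (Q : Pole W F (ι ⊕ κ)) (b : κ → Fin 3) :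
    {φ : E ⊕ ι ⊕ F → Fin 3 // (P.glue Q).Proper (Sum.elim φ b)} ≃
      Σ d : ι → Fin 3, {φ : E → Fin 3 // P.Proper (Sum.elim φ d)} ×
        {φ : F → Fin 3 // Q.Proper (Sum.elim φ (Sum.elim d b))} where
  toFun φ := ⟨φ.1 ∘ Sum.inr ∘ Sum.inl,
    ⟨φ.1 ∘ Sum.inl, by
      have := ((proper_glue P Q _).1 φ.2).1
      rwa [elim_comp_glueLeft] at this⟩,
    ⟨φ.1 ∘ Sum.inr ∘ Sum.inr, by
      have := ((proper_glue P Q _).1 φ.2).2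
      rwa [elim_comp_glueRight] at this⟩⟩
  invFun x := ⟨Sum.elim x.2.1.1 (Sum.elim x.1 x.2.2.1), by
    rw [proper_glue, elim_comp_glueLeft, elim_comp_glueRight]
    exact ⟨x.2.1.2, x.2.2.2⟩⟩
  left_inv φ := by
    apply Subtype.ext
    ext (e | i | f) <;> rfl
  right_inv x := rfl

theorem count_glue [Finite E] [Fintype ι] [DecidableEq ι] [Finite F]
    (P : Pole V E ι) (Q : Pole W F (ι ⊕ κ)) (b : κ → Fin 3) :
    (P.glue Q).count b = ∑ d : ι → Fin 3, P.count d * Q.count (Sum.elim d b) := by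
  unfold count
  rw [Nat.card_congr (glueColouring P Q b), Nat.card_sigma]
  simp only [Nat.card_prod]

/-- No loops and no multiple edges. -/
structure Simple (P : Pole V E ι) : Prop where
  loopless : ∀ e, P.src e ≠ P.tgt e
  injective : Function.Injective fun e => s(P.src e, P.tgt e)

/-- Parallel joining edges would share their end in `P`, so injectivity is needed on one side only.
This matters for `path`, where semiedges share vertices. -/
theorem Simple.glue {P : Pole V E ι} {Q : Pole W F (ι ⊕ κ)} (hP : P.Simple) (hQ : Q.Simple)
    (h : Function.Injective P.out) : (P.glue Q).Simple where
  loopless := by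
    rintro (e | i | f)
    · simpa [Pole.glue] using hP.loopless e
    · simp [Pole.glue]
    · simpa [Pole.glue] using hQ.loopless f
  injective := by
    rintro (e | i | f) (e' | i' | f') he
    · have := @hP.injective e e'
      simp_all [Pole.glue]
    · simp [Pole.glue] at he
    · simp [Pole.glue] at he
    · simp [Pole.glue] at he
    · simp [Pole.glue] at he
      rw [h he.1]
    · simp [Pole.glue] at he
    · simp [Pole.glue] at he
    · simp [Pole.glue] at he
    · have := @hQ.injective f f'
      simp_all [Pole.glue]

/-- The number of incidences of edges and semiedges with a vertex. -/
def degree [Fintype E] [Fintype ι] [DecidableEq V] (P : Pole V E ι) (v : V) : ℕ :=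
  ∑ e, ((if P.src e = v then 1 else 0) + (if P.tgt e = v then 1 else 0)) +
    ∑ i, (if P.out i = v then 1 else 0)

theorem degree_glue_inl [Fintype E] [Fintype F] [Fintype ι] [Fintype κ] [DecidableEq V]
    [DecidableEq W] (P : Pole V E ι) (Q : Pole W F (ι ⊕ κ)) (v : V) :
    (P.glue Q).degree (Sum.inl v) = P.degree v := by
  simp [degree, glue, Fintype.sum_sum_type]

theorem degree_glue_inr [Fintype E] [Fintype F] [Fintype ι] [Fintype κ] [DecidableEq V]
    [DecidableEq W] (P : Pole V E ι) (Q : Pole W F (ι ⊕ κ)) (w : W) :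
    (P.glue Q).degree (Sum.inr w) = Q.degree w := by
  simp [degree, glue, Fintype.sum_sum_type, -Finset.sum_boole]
  ring


/-! ### Boundaries of vertex sets and expansion under gluing -/

/-- The number of vertices of the set `a`. -/
def size [Fintype V] (a : V → Bool) : ℕ := ∑ v, (a v).toNat

/-- The number of edges with exactly one end in `a`. -/
def cut [Fintype E] (P : Pole V E ι) (a : V → Bool) : ℕ :=
  ∑ e, (a (P.src e) ^^ a (P.tgt e)).toNat

/-- The number of edges and semiedges that leave `a`. -/
def boundary [Fintype E] [Fintype ι] (P : Pole V E ι) (a : V → Bool) : ℕ :=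
  P.cut a + ∑ i, (a (P.out i)).toNat

/-- The set with the elements `x` and `y`. -/
def pair [DecidableEq V] (x y : V) (v : V) : Bool := decide (v = x) || decide (v = y)

theorem size_eq_card [Fintype V] (a : V → Bool) :
    size a = (Finset.univ.filter fun v => a v = true).card := by
  rw [size, Finset.card_filter]
  exact Finset.sum_congr rfl fun v _ => by cases a v <;> rfl

theorem size_sum [Fintype V] [Fintype W] (a : V ⊕ W → Bool) :
    size a = size (a ∘ Sum.inl) + size (a ∘ Sum.inr) := by
  simp [size, Fintype.sum_sum_type]

theorem size_add_size_not [Fintype V] (a : V → Bool) :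
    size a + size (fun v => !a v) = Fintype.card V := by
  rw [size, size, ← Finset.sum_add_distrib, Fintype.card, Finset.card_eq_sum_ones]
  exact Finset.sum_congr rfl fun v _ => by cases a v <;> rfl

theorem eq_pair [Fintype V] [DecidableEq V] {a : V → Bool} {x y : V} (ha : size a ≤ 2)
    (hx : a x = true) (hy : a y = true) (h : x ≠ y) : a = pair x y := by
  rw [size_eq_card] at ha
  have hs : ({x, y} : Finset V) ⊆ Finset.univ.filter fun v => a v = true := by
    intro v hv
    rcases Finset.mem_insert.1 hv with rfl | hv
    · simpa using hx
    · rw [Finset.mem_singleton.1 hv]; simpa using hy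
  have he := Finset.eq_of_subset_of_card_le hs (by rwa [Finset.card_pair h])
  ext v
  have := congrArg (v ∈ ·) he
  simp only [Finset.mem_insert, Finset.mem_singleton, Finset.mem_filter, Finset.mem_univ,
    true_and, eq_iff_iff] at this
  rw [Bool.eq_iff_iff]
  simp [pair, ← this]

theorem sum_comp_le [Fintype V] [Fintype ι] {t : ι → V} (ht : Function.Injective t)
    (a : V → Bool) : ∑ i, (a (t i)).toNat ≤ size a := by
  rw [size]
  refine (Finset.sum_map Finset.univ ⟨t, ht⟩ fun v => (a v).toNat).symm.le.trans ?_
  exact Finset.sum_le_sum_of_subset (Finset.subset_univ _)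

theorem cut_not [Fintype E] (P : Pole V E ι) (a : V → Bool) : P.cut (fun v => !a v) = P.cut a := by
  simp [cut]

theorem cut_glue [Fintype E] [Fintype F] [Fintype ι] (P : Pole V E ι) (Q : Pole W F (ι ⊕ κ))
    (a : V ⊕ W → Bool) :
    (P.glue Q).cut a = P.cut (a ∘ Sum.inl) +
      (∑ i, (a (Sum.inl (P.out i)) ^^ a (Sum.inr (Q.out (Sum.inl i)))).toNat +
        Q.cut (a ∘ Sum.inr)) := by
  simp [cut, glue, Fintype.sum_sum_type]

theorem boundary_glue [Fintype E] [Fintype F] [Fintype ι] [Fintype κ] (P : Pole V E ι)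
    (Q : Pole W F (ι ⊕ κ)) (a : V ⊕ W → Bool) :
    (P.glue Q).boundary a = (P.glue Q).cut a + ∑ k, (a (Sum.inr (Q.out (Sum.inr k)))).toNat := rfl

theorem boundary_inl_inr [Fintype F] [Fintype ι] [Fintype κ] (Q : Pole W F (ι ⊕ κ)) (b : W → Bool) :
    Q.boundary b = Q.cut b + (∑ i, (b (Q.out (Sum.inl i))).toNat +
      ∑ k, (b (Q.out (Sum.inr k))).toNat) := by
  rw [boundary, Fintype.sum_sum_type]

/-- Conditions on a cubic multipole under which it can be joined along five of its semiedges: sets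
of vertices have large boundaries, and the ends of semiedges at distance `d` are not adjacent. -/
structure Robust [Fintype V] [DecidableEq V] [Fintype E] [Fintype ι] (P : Pole V E ι)
    (f : Fin 5 → ι) (d : Fin 5) : Prop where
  simple : P.Simple
  injective : Function.Injective (P.out ∘ f)
  degree : ∀ v, P.degree v = 3
  expand : ∀ a, 1 ≤ size a → min 5 (size a + 2) ≤ P.boundary a
  apart : ∀ i, 5 ≤ P.boundary (pair (P.out (f i)) (P.out (f (i + d))))

section

variable [Fintype V] [DecidableEq V] [Fintype E] [Fintype W] [DecidableEq W] [Fintype F]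
  [Fintype κ] {P : Pole V E (Fin 5)} {Q : Pole W F (Fin 5 ⊕ κ)}

/-- Two distinct residues modulo 5 differ by `±1` or `±2`. This is why non-adjacency at distance 1
on one side of a seam and at distance 2 on the other excludes all 4-cycles across it. -/
theorem exists_ne_of_two_le_sum {c : Fin 5 → Bool} (h : 2 ≤ ∑ i, (c i).toNat) :
    ∃ i, c i = true ∧ (c (i + 1) = true ∨ c (i + 2) = true) := by
  revert c
  decide

theorem add_one_ne (i : Fin 5) : i + 1 ≠ i := by
  revert i; decide

theorem add_two_ne (i : Fin 5) : i + 2 ≠ i := by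
  revert i; decide

/-- Each joining edge inside the union removes 2 from the sum of the boundaries. At most one such
edge is harmless. Two of them force both sets to be pairs of ends, and one of the pairs is
non-adjacent and so has boundary at least 5 instead of 4. -/
theorem boundary_of_size_le_two (hP : P.Robust id 1) (hQ : Q.Robust Sum.inl 2) {a : V → Bool}
    {b : W → Bool} (ha : size a ≤ 2) (hb : size b ≤ 2) (hab : 1 ≤ size a + size b) :
    min 5 (size a + size b + 2) +
      2 * ∑ i, (a (P.out i) && b (Q.out (Sum.inl i))).toNat ≤ P.boundary a + Q.boundary b := by
  have h1 : ∑ i, (a (P.out i) && b (Q.out (Sum.inl i))).toNat ≤ size a :=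
    (Finset.sum_le_sum fun i _ => by
      show _ ≤ (a (P.out i)).toNat
      cases a (P.out i) <;> cases b (Q.out (Sum.inl i)) <;> decide).trans
      (sum_comp_le hP.injective a)
  have h2 : ∑ i, (a (P.out i) && b (Q.out (Sum.inl i))).toNat ≤ size b :=
    (Finset.sum_le_sum fun i _ => by
      show _ ≤ (b (Q.out (Sum.inl i))).toNat
      cases a (P.out i) <;> cases b (Q.out (Sum.inl i)) <;> decide).trans
      (sum_comp_le hQ.injective b)
  have h3 := hP.expand a
  have h4 := hQ.expand b
  by_cases h : 2 ≤ ∑ i, (a (P.out i) && b (Q.out (Sum.inl i))).toNat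
  · obtain ⟨i, hi, hj⟩ := exists_ne_of_two_le_sum h
    rw [Bool.and_eq_true] at hi
    rcases hj with hj | hj <;> rw [Bool.and_eq_true] at hj
    · have h5 := hP.apart i
      rw [id, id, ← eq_pair ha hi.1 hj.1 fun h => by
        have := @hP.injective i (i + 1) h
        exact absurd this (add_one_ne i).symm] at h5
      omega
    · have h5 := hQ.apart i
      rw [← eq_pair hb hi.2 hj.2 fun h => by
        have := @hQ.injective i (i + 2) h
        exact absurd this (add_two_ne i).symm] at h5
      omega
  · omega

theorem sum_xor_add (c d : Fin 5 → Bool) :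
    ∑ i, (c i ^^ d i).toNat + 2 * ∑ i, (c i && d i).toNat =
      ∑ i, (c i).toNat + ∑ i, (d i).toNat := by
  rw [Finset.mul_sum, ← Finset.sum_add_distrib, ← Finset.sum_add_distrib]
  exact Finset.sum_congr rfl fun i _ => by cases c i <;> cases d i <;> rfl

/-- Trades a lower bound for a set on one side and one for a complementary set on the other for a
bound on the cut of the union: two bounds of 5 lose only 5 across the seam. -/
theorem sum_le_sum_xor_add (c d : Fin 5 → Bool) :
    ∑ i, (c i).toNat + ∑ i, (!d i).toNat ≤ ∑ i, (c i ^^ d i).toNat + 5 := by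
  calc _ = ∑ i, ((c i).toNat + (!d i).toNat) := Finset.sum_add_distrib.symm
    _ ≤ ∑ i, ((c i ^^ d i).toNat + 1) :=
        Finset.sum_le_sum fun i _ => by cases c i <;> cases d i <;> decide
    _ = _ := by simp [Finset.sum_add_distrib]

theorem sum_xor_not (c d : Fin 5 → Bool) :
    ∑ i, (!c i ^^ !d i).toNat = ∑ i, (c i ^^ d i).toNat := by simp

theorem five_le_card (hP : P.Robust id 1) : 5 ≤ Fintype.card V := by
  simpa using Fintype.card_le_of_injective _ hP.injective

/-- Joining a robust multipole to a robust multipole whose two ends are well separated. -/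
theorem expand_glue (hP : P.Robust id 1) (hQ : Q.Robust Sum.inl 2)
    (hsep : ∀ b, 5 ≤ Q.cut b + (∑ i, (!b (Q.out (Sum.inl i))).toNat +
      ∑ k, (b (Q.out (Sum.inr k))).toNat)) (a : V ⊕ W → Bool) (ha : 1 ≤ size a) :
    min 5 (size a + 2) ≤ (P.glue Q).boundary a := by
  rw [boundary_glue, cut_glue]
  rw [size_sum] at ha ⊢
  -- Three cases. If the left part has at least 3 vertices, its boundary and the separation of `Q`
  -- are each at least 5, and `h8` combines them. If it has at most 2, its complement in `V` has at
  -- least 3; a right part with at least 3 vertices is then handled by `h9`. Two parts with at most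
  -- 2 vertices fall under `h6`.
  have hcard := five_le_card hP
  have h1 := size_add_size_not (a ∘ Sum.inl)
  have h2 := hP.expand (a ∘ Sum.inl)
  have h3 := hP.expand (fun v => !(a ∘ Sum.inl) v)
  have h4 := hQ.expand (a ∘ Sum.inr)
  have h5 := hsep (a ∘ Sum.inr)
  have h6 := boundary_of_size_le_two hP hQ (a := a ∘ Sum.inl) (b := a ∘ Sum.inr)
  have h7 := sum_xor_add (fun i => a (Sum.inl (P.out i))) fun i => a (Sum.inr (Q.out (Sum.inl i)))
  have h8 := sum_le_sum_xor_add (fun i => a (Sum.inl (P.out i)))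
    fun i => a (Sum.inr (Q.out (Sum.inl i)))
  have h9 := sum_le_sum_xor_add (fun i => !a (Sum.inl (P.out i)))
    fun i => !a (Sum.inr (Q.out (Sum.inl i)))
  rw [sum_xor_not] at h9
  rw [boundary_inl_inr] at h4 h6
  rw [boundary] at h2 h3 h6
  rw [cut_not] at h3
  simp only [Function.comp_apply, Bool.not_not] at *
  omega

/-- Closing a robust multipole with a robust multipole on five vertices. -/
theorem expand_close [IsEmpty κ] (hP : P.Robust id 1) (hQ : Q.Robust Sum.inl 2)
    (hW : Fintype.card W = 5) (a : V ⊕ W → Bool) (ha : 1 ≤ size a)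
    (ha' : 1 ≤ size fun v => !a v) :
    min 5 (min (size a) (size fun v => !a v) + 2) ≤ (P.glue Q).cut a := by
  rw [cut_glue]
  rw [size_sum] at ha ha' ⊢
  rw [size_sum fun v => !a v]
  -- As `W` has five vertices, exactly one of the right part and its complement has at least 3.
  -- Large parts of opposite sets on the two sides give 5 by `h8` or `h9`. Otherwise the set or its
  -- complement has at most 2 vertices on each side, which is `h6` or `h6'`.
  have hcard := five_le_card hP
  have h1 := size_add_size_not (a ∘ Sum.inl)
  have h1' := size_add_size_not (a ∘ Sum.inr)
  have h2 := hP.expand (a ∘ Sum.inl)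
  have h3 := hP.expand (fun v => !(a ∘ Sum.inl) v)
  have h4 := hQ.expand (a ∘ Sum.inr)
  have h5 := hQ.expand (fun v => !(a ∘ Sum.inr) v)
  have h6 := boundary_of_size_le_two hP hQ (a := a ∘ Sum.inl) (b := a ∘ Sum.inr)
  have h6' := boundary_of_size_le_two hP hQ (a := fun v => !(a ∘ Sum.inl) v)
    (b := fun v => !(a ∘ Sum.inr) v)
  have h7 := sum_xor_add (fun i => a (Sum.inl (P.out i))) fun i => a (Sum.inr (Q.out (Sum.inl i)))
  have h7' := sum_xor_add (fun i => !a (Sum.inl (P.out i)))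
    fun i => !a (Sum.inr (Q.out (Sum.inl i)))
  have h8 := sum_le_sum_xor_add (fun i => a (Sum.inl (P.out i)))
    fun i => a (Sum.inr (Q.out (Sum.inl i)))
  have h9 := sum_le_sum_xor_add (fun i => !a (Sum.inl (P.out i)))
    fun i => !a (Sum.inr (Q.out (Sum.inl i)))
  rw [sum_xor_not] at h9 h7'
  simp only [boundary_inl_inr, Finset.univ_eq_empty, Finset.sum_empty] at h4 h5 h6 h6'
  rw [boundary] at h2 h3 h6 h6'
  rw [cut_not] at h3 h5 h6'
  rw [cut_not] at h6'
  simp only [Function.comp_def, Bool.not_not] at *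
  omega

theorem Robust.glue (hP : P.Robust id 1) (hQ : Q.Robust Sum.inl 2)
    (hsep : ∀ b, 5 ≤ Q.cut b + (∑ i, (!b (Q.out (Sum.inl i))).toNat +
      ∑ k, (b (Q.out (Sum.inr k))).toNat)) {f : Fin 5 → κ} {d : Fin 5}
    (hf : Function.Injective (Q.out ∘ Sum.inr ∘ f))
    (hd : ∀ i, 5 ≤ Q.boundary (pair (Q.out (Sum.inr (f i))) (Q.out (Sum.inr (f (i + d)))))) :
    (P.glue Q).Robust f d where
  simple := hP.simple.glue hQ.simple hP.injective
  injective := Sum.inr_injective.comp hf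
  degree := by
    rintro (v | w)
    · rw [degree_glue_inl, hP.degree]
    · rw [degree_glue_inr, hQ.degree]
  expand := expand_glue hP hQ hsep
  -- The outer ends lie in `Q`, and the joining edges contribute to the boundary of a set inside `Q`
  -- what the semiedges did before.
  apart i := by
    have h := hd i
    rw [boundary_inl_inr] at h
    have h1 (x y : W) : (pair (Sum.inr x) (Sum.inr y) : V ⊕ W → Bool) ∘ Sum.inl =
        fun _ => false := by ext v; simp [pair]
    have h2 (x y : W) : (pair (Sum.inr x) (Sum.inr y) : V ⊕ W → Bool) ∘ Sum.inr =
        pair x y := by ext v; simp [pair]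
    have h3 (x y : W) (v : V) : (pair (Sum.inr x) (Sum.inr y) : V ⊕ W → Bool) (Sum.inl v) =
        false := by simp [pair]
    have h4 (x y w : W) : (pair (Sum.inr x) (Sum.inr y) : V ⊕ W → Bool) (Sum.inr w) =
        pair x y w := by simp [pair]
    rw [boundary_glue, cut_glue]
    simp only [Pole.glue, Function.comp_apply, h1, h2, h3, h4, Bool.false_bne]
    omega

end


/-! ### From multipoles to simple graphs and their edge colourings -/

/-- The graph formed by the edges of a multipole. -/
def graph (P : Pole V E ι) : SimpleGraph V :=
  SimpleGraph.fromEdgeSet (Set.range fun e => s(P.src e, P.tgt e))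

theorem graph_adj (P : Pole V E ι) (x y : V) :
    P.graph.Adj x y ↔ (∃ e, s(P.src e, P.tgt e) = s(x, y)) ∧ x ≠ y := by
  simp [graph]

theorem Simple.mem_edgeSet {P : Pole V E ι} (hP : P.Simple) (x : Sym2 V) :
    x ∈ P.graph.edgeSet ↔ ∃ e, s(P.src e, P.tgt e) = x := by
  rw [graph, SimpleGraph.edgeSet_fromEdgeSet, Set.mem_sdiff, Set.mem_range]
  refine ⟨fun h => h.1, fun h => ⟨h, ?_⟩⟩
  obtain ⟨e, rfl⟩ := h
  simpa using hP.loopless e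

/-- The edges of a simple multipole are the edges of its graph. -/
noncomputable def Simple.edgeEquiv {P : Pole V E ι} (hP : P.Simple) : E ≃ P.graph.edgeSet :=
  Equiv.ofBijective (fun e => ⟨s(P.src e, P.tgt e), (hP.mem_edgeSet _).2 ⟨e, rfl⟩⟩)
    ⟨fun e e' h => hP.injective (congrArg Subtype.val h), fun x => by
      obtain ⟨e, he⟩ := (hP.mem_edgeSet x.1).1 x.2
      exact ⟨e, Subtype.ext he⟩⟩

theorem Simple.coe_edgeEquiv {P : Pole V E ι} (hP : P.Simple) (e : E) :
    (hP.edgeEquiv e : Sym2 V) = s(P.src e, P.tgt e) := rfl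

theorem Simple.lineGraph_adj {P : Pole V E ι} (hP : P.Simple) (e e' : E) :
    P.graph.lineGraph.Adj (hP.edgeEquiv e) (hP.edgeEquiv e') ↔
      e ≠ e' ∧ ∃ v, P.Inc (Sum.inl e) v ∧ P.Inc (Sum.inl e') v := by
  rw [SimpleGraph.lineGraph_adj_iff_exists, hP.edgeEquiv.injective.ne_iff]
  refine and_congr_right fun _ => exists_congr fun v => and_congr ?_ ?_ <;>
  · rw [hP.coe_edgeEquiv, Sym2.mem_iff, Inc]
    exact or_congr eq_comm eq_comm

/-- Edge colourings of the graph of a simple multipole without semiedges. -/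
noncomputable def Simple.colouringEquiv [IsEmpty ι] {P : Pole V E ι} (hP : P.Simple)
    (b : ι → Fin 3) :
    P.graph.ThreeEdgeColouring ≃ {φ : E → Fin 3 // P.Proper (Sum.elim φ b)} where
  toFun c := ⟨fun e => c (hP.edgeEquiv e), by
    rintro (e | i) (e' | i') v he he' h
    · by_contra hne
      exact c.valid ((hP.lineGraph_adj e e').2 ⟨fun h => hne (by rw [h]), v, he, he'⟩) h
    · exact isEmptyElim i'
    · exact isEmptyElim i
    · exact isEmptyElim i⟩
  invFun φ := SimpleGraph.Coloring.mk (fun x => φ.1 (hP.edgeEquiv.symm x)) fun {x y} h hc => by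
    obtain ⟨e, rfl⟩ := hP.edgeEquiv.surjective x
    obtain ⟨e', rfl⟩ := hP.edgeEquiv.surjective y
    obtain ⟨hne, v, he, he'⟩ := (hP.lineGraph_adj e e').1 h
    rw [Equiv.symm_apply_apply, Equiv.symm_apply_apply] at hc
    exact hne (Sum.inl_injective (φ.2 (Sum.inl e) (Sum.inl e') v he he' hc))
  left_inv c := RelHom.ext fun x => congrArg c (hP.edgeEquiv.apply_symm_apply x)
  right_inv φ := Subtype.ext (funext fun e => congrArg φ.1 (hP.edgeEquiv.symm_apply_apply e))

theorem Simple.card_colouring [IsEmpty ι] {P : Pole V E ι} (hP : P.Simple) (b : ι → Fin 3) :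
    Nat.card P.graph.ThreeEdgeColouring = P.count b :=
  Nat.card_congr (hP.colouringEquiv b)

/-- Edge colourings are transported along graph isomorphisms. -/
theorem card_colouring_congr {G : SimpleGraph V} {H : SimpleGraph W} (f : G ≃g H) :
    Nat.card G.ThreeEdgeColouring = Nat.card H.ThreeEdgeColouring := by
  have key {V W : Type} {G : SimpleGraph V} {H : SimpleGraph W} (f : G ≃g H)
      {x y : G.edgeSet} (h : G.lineGraph.Adj x y) :
      H.lineGraph.Adj (f.mapEdgeSet x) (f.mapEdgeSet y) := by
    rw [SimpleGraph.lineGraph_adj_iff_exists] at h ⊢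
    obtain ⟨hne, v, hx, hy⟩ := h
    exact ⟨f.mapEdgeSet.injective.ne hne, f v, Sym2.mem_map.2 ⟨v, hx, rfl⟩,
      Sym2.mem_map.2 ⟨v, hy, rfl⟩⟩
  have key' {x y : H.edgeSet} (h : H.lineGraph.Adj x y) :
      G.lineGraph.Adj (f.mapEdgeSet.symm x) (f.mapEdgeSet.symm y) := key f.symm h
  let L : G.lineGraph ≃g H.lineGraph :=
    ⟨f.mapEdgeSet, fun {x y} => ⟨fun h => by
      have := key' h
      rwa [Equiv.symm_apply_apply, Equiv.symm_apply_apply] at this, key f⟩⟩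
  exact Nat.card_congr
    { toFun := fun c => c.comp L.symm.toHom
      invFun := fun c => c.comp L.toHom
      left_inv := fun c => by ext x; simp
      right_inv := fun c => by ext x; simp }

/-! ### Expansion implies the snark conditions -/

theorem card_le_size [Fintype V] {s : Finset V} {a : V → Bool} (h : ∀ v ∈ s, a v = true) :
    s.card ≤ size a := by
  rw [size_eq_card]
  exact Finset.card_le_card fun v hv => by simpa using h v hv

section

variable [DecidableEq V] [Fintype E] {P : Pole V E ι}

theorem ncard_neighborSet (hP : P.Simple) (v : V) :
    (P.graph.neighborSet v).ncard =
      ∑ e, ((if P.src e = v then 1 else 0) + (if P.tgt e = v then 1 else 0)) := by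
  have h : P.graph.neighborSet v =
      (fun e => if P.src e = v then P.tgt e else P.src e) ''
        {e | P.src e = v ∨ P.tgt e = v} := by
    ext x
    rw [SimpleGraph.mem_neighborSet, graph_adj]
    constructor
    · rintro ⟨⟨e, he⟩, hne⟩
      rcases Sym2.eq_iff.1 he with ⟨h1, h2⟩ | ⟨h1, h2⟩
      · exact ⟨e, Or.inl h1, by simp [h1, h2]⟩
      · exact ⟨e, Or.inr h2, by simp [h1, hne.symm]⟩
    · rintro ⟨e, he, rfl⟩
      have hl := hP.loopless e
      by_cases h1 : P.src e = v
      · simp only [h1, if_true]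
        exact ⟨⟨e, by rw [h1]⟩, h1 ▸ hl⟩
      · have h2 := he.resolve_left h1
        simp only [h1, if_false]
        exact ⟨⟨e, by rw [h2, Sym2.eq_swap]⟩, fun h => h1 h.symm⟩
  rw [h, Set.InjOn.ncard_image]
  · rw [← Finset.coe_filter_univ, Set.ncard_coe_finset, Finset.card_filter]
    refine Finset.sum_congr rfl fun e _ => ?_
    have hl := hP.loopless e
    by_cases h1 : P.src e = v
    · have h2 : P.tgt e ≠ v := fun h2 => hl (h1.trans h2.symm)
      simp [h1, h2]
    · simp [h1]
  · intro e he e' he' h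
    apply hP.injective
    simp only [Set.mem_ofPred_eq] at he he' h ⊢
    rw [Sym2.eq_iff]
    split_ifs at h with h1 h2 h2
    · exact Or.inl ⟨h1.trans h2.symm, h⟩
    · exact Or.inr ⟨h1.trans (he'.resolve_left h2).symm, h⟩
    · exact Or.inr ⟨h, (he.resolve_left h1).trans h2.symm⟩
    · exact Or.inl ⟨h, (he.resolve_left h1).trans (he'.resolve_left h2).symm⟩

theorem cut_le_card (hP : P.Simple) (S : Finset (Sym2 V)) (a : V → Bool)
    (h : ∀ x y, s(x, y) ∉ S → P.graph.Adj x y → a x = a y) : P.cut a ≤ S.card := by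
  have h1 : P.cut a = (Finset.univ.filter fun e => (a (P.src e) ^^ a (P.tgt e)) = true).card := by
    rw [cut, Finset.card_filter]
    exact Finset.sum_congr rfl fun e _ => by cases a (P.src e) <;> cases a (P.tgt e) <;> rfl
  rw [h1]
  refine Finset.card_le_card_of_injOn (fun e => s(P.src e, P.tgt e)) ?_ hP.injective.injOn
  intro e he
  by_contra hS
  have := h _ _ hS ((graph_adj P _ _).2 ⟨⟨e, rfl⟩, hP.loopless e⟩)
  simp [this] at he

variable [Fintype V]

/-- Count the incidences of edges with vertices of the set: an inner edge has two, a cut edge one,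
and each vertex three. -/
theorem cut_add_inside
    (hdeg : ∀ v, ∑ e, ((if P.src e = v then 1 else 0) + (if P.tgt e = v then 1 else 0)) = 3)
    (a : V → Bool) :
    P.cut a + 2 * ∑ e, (a (P.src e) && a (P.tgt e)).toNat = 3 * size a := by
  have h1 : ∑ e, ((a (P.src e)).toNat + (a (P.tgt e)).toNat) = 3 * size a := by
    have h2 (v : V) : 3 * (a v).toNat = ∑ e, ((if P.src e = v then (a v).toNat else 0) +
        (if P.tgt e = v then (a v).toNat else 0)) := by
      rw [← hdeg v, Finset.sum_mul]
      refine Finset.sum_congr rfl fun e _ => ?_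
      simp [add_mul]
    rw [size, Finset.mul_sum, Finset.sum_congr rfl fun v _ => h2 v, Finset.sum_comm]
    refine Finset.sum_congr rfl fun e _ => ?_
    rw [Finset.sum_add_distrib]
    simp
  rw [← h1, cut, Finset.mul_sum, ← Finset.sum_add_distrib]
  exact Finset.sum_congr rfl fun e _ => by cases a (P.src e) <;> cases a (P.tgt e) <;> rfl

theorem three_le_size {G : SimpleGraph V} {x : V} {p : G.Walk x x} (hp : p.IsCycle)
    {a : V → Bool} (h : ∀ v ∈ p.support, a v = true) : 3 ≤ size a := by
  refine le_trans ?_ (card_le_size (s := p.support.tail.toFinset) fun v hv =>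
    h v (List.mem_of_mem_tail (List.mem_toFinset.1 hv)))
  rw [List.toFinset_card_of_nodup hp.support_nodup, List.length_tail, SimpleGraph.Walk.length_support]
  exact hp.three_le_length

variable (hP : P.Simple)
  (hdeg : ∀ v, ∑ e, ((if P.src e = v then 1 else 0) + (if P.tgt e = v then 1 else 0)) = 3)
  (hexp : ∀ a : V → Bool, 1 ≤ size a → 1 ≤ size (fun v => !a v) →
    min 5 (min (size a) (size fun v => !a v) + 2) ≤ P.cut a)

include hP hexp in
-- Take the component of one cycle after deleting `S`. If the other cycle is elsewhere, both sides
-- have at least 3 vertices, so the cut has at least 5 edges; but all cut edges lie in `S`.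
theorem graph_cyclicallyEdgeConnected : P.graph.CyclicallyEdgeConnected 5 := by
  classical
  intro x y p q hp hq hpq S _ hS hpS hqS
  by_contra hxy
  let a : V → Bool := fun v => decide ((P.graph.deleteEdges (S : Set (Sym2 V))).Reachable x v)
  have h1 : ∀ v ∈ p.support, a v = true := fun v hv => by
    have hv' : v ∈ (p.toDeleteEdges (S : Set (Sym2 V))
        fun e he => by simpa using hpS e he).support := by
      simpa [SimpleGraph.Walk.toDeleteEdges] using hv
    simpa [a] using ⟨(SimpleGraph.Walk.takeUntil _ v hv')⟩
  have h2 : ∀ v ∈ q.support, (!a v) = true := fun v hv => by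
    have hv' : v ∈ (q.toDeleteEdges (S : Set (Sym2 V))
        fun e he => by simpa using hqS e he).support := by
      simpa [SimpleGraph.Walk.toDeleteEdges] using hv
    have hr : (P.graph.deleteEdges (S : Set (Sym2 V))).Reachable y v :=
      ⟨(SimpleGraph.Walk.takeUntil _ v hv')⟩
    simp only [a, Bool.not_eq_true', decide_eq_false_iff_not]
    exact fun h => hxy (h.trans hr.symm)
  have h3 := three_le_size hp h1
  have h4 := three_le_size hq h2
  have h5 := hexp a (by omega) (by omega)
  have h6 : P.cut a ≤ S.card := cut_le_card hP S a fun u v hS huv => by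
    have huv' : (P.graph.deleteEdges (S : Set (Sym2 V))).Adj u v := by
      rw [SimpleGraph.deleteEdges_adj]
      exact ⟨huv, by simpa using hS⟩
    simp only [a, decide_eq_decide]
    exact ⟨fun h => h.trans huv'.reachable, fun h => h.trans huv'.symm.reachable⟩
  omega

include hP hexp in
theorem graph_connected [Nonempty V] : P.graph.Connected := by
  classical
  refine ⟨fun x y => ?_⟩
  by_contra hxy
  let a : V → Bool := fun v => decide (P.graph.Reachable x v)
  have h1 : 1 ≤ size a := card_le_size (s := {x}) fun v hv => by
    simp [a, Finset.mem_singleton.1 hv]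
  have h2 : 1 ≤ size fun v => !a v := card_le_size (s := {y}) fun v hv => by
    simpa [a, Finset.mem_singleton.1 hv] using hxy
  have h3 := hexp a h1 h2
  have h4 : P.cut a ≤ (∅ : Finset (Sym2 V)).card := cut_le_card hP ∅ a fun u v _ huv => by
    simp only [a, decide_eq_decide]
    exact ⟨fun h => h.trans huv.reachable, fun h => h.trans huv.symm.reachable⟩
  rw [Finset.card_empty] at h4
  omega

include hP hdeg hexp in
theorem five_le_egirth_graph (hV : 7 ≤ Fintype.card V) : 5 ≤ P.graph.egirth := by
  classical
  rw [← Nat.cast_ofNat, SimpleGraph.le_egirth]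
  intro x p hp
  rw [Nat.cast_ofNat, ← Nat.cast_ofNat, Nat.cast_le]
  by_contra hlt
  let a : V → Bool := fun v => decide (v ∈ p.support)
  have h1 : 3 ≤ size a := three_le_size hp fun v hv => by simpa [a] using hv
  have h2 : size a ≤ p.length := by
    rw [size_eq_card]
    refine (Finset.card_le_card (t := p.support.tail.toFinset) fun v hv => ?_).trans ?_
    · rw [Finset.mem_filter, decide_eq_true_eq] at hv
      rw [List.mem_toFinset]
      exact (SimpleGraph.Walk.mem_support_iff p).1 hv.2 |>.elim
        (fun h => h ▸ SimpleGraph.Walk.end_mem_tail_support hp.not_nil) id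
    · refine (List.toFinset_card_le _).trans ?_
      rw [List.length_tail, SimpleGraph.Walk.length_support]
      simp
  have h3 : p.length ≤ ∑ e, (a (P.src e) && a (P.tgt e)).toNat := by
    have h4 : ∑ e, (a (P.src e) && a (P.tgt e)).toNat =
        (Finset.univ.filter fun e => (a (P.src e) && a (P.tgt e)) = true).card := by
      rw [Finset.card_filter]
      exact Finset.sum_congr rfl fun e _ => by cases a (P.src e) <;> cases a (P.tgt e) <;> rfl
    rw [h4, ← SimpleGraph.Walk.length_edges, ← List.toFinset_card_of_nodup hp.edges_nodup]
    refine Finset.card_le_card_of_surjOn (fun e => s(P.src e, P.tgt e)) fun d hd => ?_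
    have hd' : d ∈ p.edges := by simpa using hd
    obtain ⟨e, rfl⟩ := (hP.mem_edgeSet d).1 (p.edges_subset_edgeSet hd')
    refine ⟨e, ?_, rfl⟩
    simp [a, p.fst_mem_support_of_mem_edges hd', p.snd_mem_support_of_mem_edges hd']
  -- A cycle of length `l ≤ 4` on `s ≤ l` vertices has at least `l` inner edges, so its cut is at
  -- most `3 * s - 2 * l ≤ 4`. With at least 3 vertices inside and, by `hV`, at least 3 outside,
  -- expansion demands 5.
  have h5 := cut_add_inside hdeg a
  have h6 := size_add_size_not a
  have h7 := hexp a (by omega) (by omega)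
  omega

include hP hdeg hexp in
theorem graph_isSnark (hV : 7 ≤ Fintype.card V) (hc : IsEmpty P.graph.ThreeEdgeColouring) :
    P.graph.IsSnark where
  finite := inferInstance
  connected := by
    have : Nonempty V := Fintype.card_pos_iff.1 (by omega)
    exact graph_connected hP hexp
  cubic v := by rw [ncard_neighborSet hP, hdeg]
  girth := five_le_egirth_graph hP hdeg hexp hV
  cyclically := fun x y p q hp hq hpq S hS hS4 =>
    graph_cyclicallyEdgeConnected hP hexp p q hp hq hpq S hS (by omega)
  uncolourable := hc

end


/-! ### Pentagons, and edge subtraction as replacement of a pentagon by a path -/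

theorem graph_glue_inl_inl (P : Pole V E ι) (Q : Pole W F (ι ⊕ κ)) (x y : V) :
    (P.glue Q).graph.Adj (Sum.inl x) (Sum.inl y) ↔ P.graph.Adj x y := by
  simp [graph_adj, glue, Sum.exists]

theorem graph_glue_inr_inr (P : Pole V E ι) (Q : Pole W F (ι ⊕ κ)) (x y : W) :
    (P.glue Q).graph.Adj (Sum.inr x) (Sum.inr y) ↔ Q.graph.Adj x y := by
  simp [graph_adj, glue, Sum.exists]

theorem graph_glue_inl_inr (P : Pole V E ι) (Q : Pole W F (ι ⊕ κ)) (x : V) (y : W) :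
    (P.glue Q).graph.Adj (Sum.inl x) (Sum.inr y) ↔
      ∃ i, P.out i = x ∧ Q.out (Sum.inl i) = y := by
  simp [graph_adj, glue, Sum.exists]

theorem graph_glue_inr_inl (P : Pole V E ι) (Q : Pole W F (ι ⊕ κ)) (x : V) (y : W) :
    (P.glue Q).graph.Adj (Sum.inr y) (Sum.inl x) ↔
      ∃ i, P.out i = x ∧ Q.out (Sum.inl i) = y := by
  rw [SimpleGraph.adj_comm, graph_glue_inl_inr]

/-- The indicator of the colourings of the five semiedges of a pentagon, numbered with steps of two
around it, that extend to the pentagon. -/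
def pentagramWeight (b : Fin 5 → Fin 3) : ℕ :=
  if ∃ i, b (i + 1) = b (i + 3) ∧ b (i + 3) = b (i + 4) ∧ b i ≠ b (i + 2) ∧ b i ≠ b (i + 1) ∧
    b (i + 2) ≠ b (i + 1) then 1 else 0

/-- A pentagon whose semiedges are numbered with steps of two around it. -/
def pentagram : Pole (Fin 5) (Fin 5) (Fin 5) := ⟨id, (· + 1), (2 * ·)⟩

/-- A pentagon with its five semiedges in cyclic order. -/
def pentagon : Pole (Fin 5) (Fin 5) (Fin 5 ⊕ Fin 0) := ⟨id, (· + 1), Sum.elim id Fin.elim0⟩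

/-- The path that arises from the pentagon by removing the vertices `0` and `1` and joining the
edges that remain at each of them. -/
def path : Pole (Fin 3) (Fin 2) (Fin 5 ⊕ Fin 0) :=
  ⟨Fin.castSucc, Fin.succ, Sum.elim ![2, 0, 0, 1, 2] Fin.elim0⟩

theorem pentagon_simple : pentagon.Simple := ⟨by decide, by unfold Function.Injective; decide⟩

theorem pentagram_simple : pentagram.Simple := ⟨by decide, by unfold Function.Injective; decide⟩

theorem path_simple : path.Simple := ⟨by decide, by unfold Function.Injective; decide⟩

/-- Vertices at distance two on a pentagon are not adjacent. In `pentagram` these are the ends of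
consecutively numbered semiedges, hence the parameter 2 here and 1 there. -/
theorem pentagon_robust : pentagon.Robust Sum.inl 2 where
  simple := pentagon_simple
  injective := by unfold Function.Injective; decide
  degree := by decide
  expand := by decide
  apart := by decide

theorem pentagram_robust : pentagram.Robust id 1 where
  simple := pentagram_simple
  injective := by unfold Function.Injective; decide
  degree := by decide
  expand := by decide
  apart := by decide

theorem pentagon_adj (i j : Fin 5) : pentagon.graph.Adj i j ↔ i + 1 = j ∨ j + 1 = i := by
  rw [graph_adj]
  revert i j
  decide

theorem path_adj (i j : Fin 3) :
    path.graph.Adj i j ↔ i.val + 1 = j.val ∨ j.val + 1 = i.val := by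
  rw [graph_adj]
  revert i j
  decide

/-- The vertices that remain when `0` and `1` are removed from a pentagon glued to a multipole. -/
def pathVertex (x : V ⊕ Fin 3) :
    {x : V ⊕ Fin 5 // x ∉ s(Sum.inr (0 : Fin 5), Sum.inr (1 : Fin 5))} :=
  ⟨Sum.map id ![2, 3, 4] x, by
    rcases x with x | i
    · simp
    · revert i
      simp [Fin.forall_fin_succ]⟩

theorem pathVertex_bijective : Function.Bijective (pathVertex : V ⊕ Fin 3 → _) := by
  constructor
  · intro x y h
    refine Sum.map_injective.2 ⟨Function.injective_id, ?_⟩ (congrArg Subtype.val h)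
    unfold Function.Injective
    decide
  · rintro ⟨x | i, h⟩
    · exact ⟨Sum.inl x, rfl⟩
    · fin_cases i
      · simp at h
      · simp at h
      · exact ⟨Sum.inr 0, rfl⟩
      · exact ⟨Sum.inr 1, rfl⟩
      · exact ⟨Sum.inr 2, rfl⟩

/-- Removing two adjacent vertices of a pentagon leaves a path. -/
noncomputable def pathIso (P : Pole V E (Fin 5)) :
    (P.glue path).graph ≃g
      (P.glue pentagon).graph.edgeSubtract s(Sum.inr (0 : Fin 5), Sum.inr (1 : Fin 5)) where
  toEquiv := Equiv.ofBijective pathVertex pathVertex_bijective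
  map_rel_iff' := by
    intro x y
    show (pathVertex x ≠ pathVertex y ∧ ((P.glue pentagon).graph.Adj (pathVertex x).1
      (pathVertex y).1 ∨ ∃ w ∈ s(Sum.inr (0 : Fin 5), Sum.inr (1 : Fin 5)),
        (P.glue pentagon).graph.Adj w (pathVertex x).1 ∧
          (P.glue pentagon).graph.Adj w (pathVertex y).1)) ↔ _
    rw [pathVertex_bijective.injective.ne_iff]
    simp only [Sym2.mem_iff, or_and_right, exists_or, exists_eq_left]
    rcases x with x | i <;> rcases y with y | j
    · simp only [pathVertex, Sum.map_inl, id, graph_glue_inl_inl, graph_glue_inr_inl]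
      constructor
      · rintro ⟨hne, h | ⟨⟨i, h1, h2⟩, ⟨j, h3, h4⟩⟩ | ⟨⟨i, h1, h2⟩, ⟨j, h3, h4⟩⟩⟩
        · exact h
        -- A removed pentagon vertex has only one neighbour outside the pentagon, so no new edge has
        -- both ends in `V`.
        · exact absurd (by rw [← h1, ← h3, show i = j from h2.trans h4.symm]) hne
        · exact absurd (by rw [← h1, ← h3, show i = j from h2.trans h4.symm]) hne
      · exact fun h => ⟨fun h' => h.ne (Sum.inl_injective h'), Or.inl h⟩
    · simp only [pathVertex, Sum.map_inl, Sum.map_inr, id, graph_glue_inl_inr, graph_glue_inr_inl,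
        graph_glue_inr_inr, pentagon_adj]
      simp only [pentagon, path, Sum.elim_inl, id]
      revert j
      simpa [Fin.forall_fin_succ, Fin.exists_fin_succ] using ⟨or_comm, or_comm⟩
    · simp only [pathVertex, Sum.map_inl, Sum.map_inr, id, graph_glue_inr_inl,
        graph_glue_inr_inr, pentagon_adj]
      simp only [pentagon, path, Sum.elim_inl, id]
      revert i
      simpa [Fin.forall_fin_succ, Fin.exists_fin_succ] using ⟨or_comm, or_comm⟩
    · simp only [pathVertex, Sum.map_inr, graph_glue_inr_inr, pentagon_adj, path_adj,
        Sum.inr_injective.ne_iff]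
      revert i j
      decide

/-! ### Initial pieces, multipliers and the closed snark -/

/-- A cubic multipole with five semiedges whose boundary behaves like that of a pentagon, but with
`N` colourings for each colouring of the boundary that extends. -/
structure IsPentagram [Fintype V] [DecidableEq V] [Fintype E] (P : Pole V E (Fin 5)) (N : ℕ) :
    Prop where
  robust : P.Robust id 1
  count_eq : ∀ b, P.count b = N * pentagramWeight b

/-- A cubic multipole that multiplies the number of colourings by `N` when it is joined to a
multipole with `IsPentagram`. -/
structure IsMultiplier [Fintype W] [DecidableEq W] [Fintype F] (Q : Pole W F (Fin 5 ⊕ Fin 5))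
    (N : ℕ) : Prop where
  robust : Q.Robust Sum.inl 2
  separated : ∀ b, 5 ≤ Q.cut b + (∑ i, (!b (Q.out (Sum.inl i))).toNat +
    ∑ k, (b (Q.out (Sum.inr k))).toNat)
  injective : Function.Injective (Q.out ∘ Sum.inr)
  apart : ∀ i, 5 ≤ Q.boundary (pair (Q.out (Sum.inr i)) (Q.out (Sum.inr (i + 1))))
  sum_eq : ∀ b, ∑ d, pentagramWeight d * Q.count (Sum.elim d b) = N * pentagramWeight b

theorem IsPentagram.glue [Fintype V] [DecidableEq V] [Fintype E] [Fintype W] [DecidableEq W]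
    [Fintype F] {P : Pole V E (Fin 5)} {Q : Pole W F (Fin 5 ⊕ Fin 5)} {M N : ℕ}
    (hP : P.IsPentagram M) (hQ : Q.IsMultiplier N) : (P.glue Q).IsPentagram (M * N) where
  robust := hP.robust.glue hQ.robust hQ.separated hQ.injective hQ.apart
  count_eq b := by
    rw [count_glue, mul_assoc, ← hQ.sum_eq b, Finset.mul_sum]
    exact Finset.sum_congr rfl fun d _ => by rw [hP.count_eq, mul_assoc]

/-- By linearity of gluing, the closed graph has `N` times the colourings of the Petersen graph,
namely none, and the subtracted graph has `N` times those of the edge-subtracted Petersen graph,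
namely `18 * N`. -/
theorem IsPentagram.exists_snark [Fintype V] [DecidableEq V] [Fintype E] {P : Pole V E (Fin 5)}
    {N : ℕ} (hP : P.IsPentagram N)
    (hpentagon : ∀ b, ∑ d, pentagramWeight d * pentagon.count (Sum.elim d b) = 0)
    (hpath : ∀ b, ∑ d, pentagramWeight d * path.count (Sum.elim d b) = 18) :
    ∃ (V : Type) (G : SimpleGraph V) (e : Sym2 V),
      G.IsSnark ∧ G.CyclicallyEdgeConnected 5 ∧ e ∈ G.edgeSet ∧ G.psi e = N := by
  have hs : (P.glue pentagon).Simple := hP.robust.simple.glue pentagon_simple hP.robust.injective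
  have hs' : (P.glue path).Simple := hP.robust.simple.glue path_simple hP.robust.injective
  have hcount {W F : Type} [Fintype F] (Q : Pole W F (Fin 5 ⊕ Fin 0)) (b : Fin 0 → Fin 3) :
      (P.glue Q).count b = N * ∑ d, pentagramWeight d * Q.count (Sum.elim d b) := by
    rw [count_glue, Finset.mul_sum]
    exact Finset.sum_congr rfl fun d _ => by rw [hP.count_eq, mul_assoc]
  have hexp := expand_close hP.robust pentagon_robust (Fintype.card_fin 5)
  have hdeg : ∀ v, ∑ e, ((if (P.glue pentagon).src e = v then 1 else 0) +
      (if (P.glue pentagon).tgt e = v then 1 else 0)) = 3 := by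
    rintro (v | w)
    · have h := degree_glue_inl P pentagon v
      rw [hP.robust.degree] at h
      simpa [degree, -Finset.sum_boole] using h
    · have h := degree_glue_inr P pentagon w
      rw [pentagon_robust.degree] at h
      simpa [degree, -Finset.sum_boole] using h
  refine ⟨V ⊕ Fin 5, (P.glue pentagon).graph, s(Sum.inr (0 : Fin 5), Sum.inr (1 : Fin 5)),
    graph_isSnark hs hdeg hexp ?_ ?_, graph_cyclicallyEdgeConnected hs hexp, ?_, ?_⟩
  · have := five_le_card hP.robust
    rw [Fintype.card_sum, Fintype.card_fin]
    omega
  · have h := hs.card_colouring Fin.elim0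
    rw [hcount, hpentagon, mul_zero] at h
    -- `Nat.card` also vanishes on infinite types, so finiteness is needed to conclude emptiness.
    have : Finite (P.glue pentagon).graph.ThreeEdgeColouring :=
      Finite.of_equiv _ (hs.colouringEquiv Fin.elim0).symm
    exact Finite.card_eq_zero_iff.1 h
  · rw [SimpleGraph.mem_edgeSet, graph_glue_inr_inr, pentagon_adj]
    exact Or.inl rfl
  · rw [SimpleGraph.psi, ← card_colouring_congr (pathIso P), hs'.card_colouring Fin.elim0, hcount,
      hpath]
    push_cast
    ring


/-! ### A verified search through vertex sets -/

/-- Search through the sets of vertices, one vertex at a time, for a set with fewer than five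
boundary edges that violates `g`. A row lists the earlier neighbours of a vertex and the numbers of
boundary edges that the vertex contributes in itself if it is in the set, or not in the set. The
digits of `m` encode the choices made so far. -/
def cutSearch (g : ℕ → ℕ → Bool) : List (List ℕ × ℕ × ℕ) → ℕ → ℕ → ℕ → ℕ → Bool
  | [], _, _, c, s => Nat.ble 5 c || g c s
  | r :: rs, k, m, c, s => Nat.ble 5 c ||
      (cutSearch g rs (k + 1) (m + 2 ^ k)
          (c + (r.1.map fun j => 1 - m / 2 ^ j % 2).sum + r.2.1) (s + 1) &&
        cutSearch g rs (k + 1) m (c + (r.1.map fun j => m / 2 ^ j % 2).sum + r.2.2) s)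

/-- The neighbours in the rows precede the vertices of the rows. -/
def RowsLt : List (List ℕ) → ℕ → Prop
  | [], _ => True
  | r :: rs, k => (∀ j ∈ r, j < k) ∧ RowsLt rs (k + 1)

/-- The boundary that a vertex contributes to the set `a`. -/
def rowCost (a : ℕ → Bool) (k : ℕ) (r : List ℕ × ℕ × ℕ) : ℕ :=
  (r.1.map fun j => (a j ^^ a k).toNat).sum + if a k then r.2.1 else r.2.2

/-- The boundary of the set `a`, computed from the rows. -/
def rowsCost (a : ℕ → Bool) : List (List ℕ × ℕ × ℕ) → ℕ → ℕ
  | [], _ => 0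
  | r :: rs, k => rowCost a k r + rowsCost a rs (k + 1)

/-- The number of elements of the set `a` among `n` vertices from `k` on. -/
def rowsSize (a : ℕ → Bool) : ℕ → ℕ → ℕ
  | 0, _ => 0
  | n + 1, k => (a k).toNat + rowsSize a n (k + 1)

theorem digit_add_lt {b m k j y : ℕ} (hj : j < k) :
    (m + y * b ^ k) / b ^ j % b = m / b ^ j % b := by
  rcases Nat.eq_zero_or_pos b with rfl | hb
  · simp [Nat.ne_of_gt (Nat.zero_lt_of_lt hj)]
  obtain ⟨d, rfl⟩ := Nat.exists_eq_add_of_lt hj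
  rw [show y * b ^ (j + d + 1) = b ^ j * (b * (y * b ^ d)) by ring,
    Nat.add_mul_div_left _ _ (pow_pos hb j), Nat.add_mul_mod_self_left]

theorem digit_add_self {b m k y : ℕ} (hm : m < b ^ k) (hy : y < b) :
    (m + y * b ^ k) / b ^ k % b = y := by
  rw [Nat.add_mul_div_right _ _ (Nat.zero_lt_of_lt hm), Nat.div_eq_of_lt hm, zero_add,
    Nat.mod_eq_of_lt hy]

theorem add_mul_pow_lt {b m k y : ℕ} (hm : m < b ^ k) (hy : y < b) :
    m + y * b ^ k < b ^ (k + 1) := by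
  have : (y + 1) * b ^ k ≤ b * b ^ k := Nat.mul_le_mul_right _ hy
  rw [pow_succ']
  linarith

/-- Follow the branch that agrees with `a`: the digits of `m` are then the values of `a` so far.
Stopping at cost 5 is sound because later rows only add to the cost. -/
theorem cutSearch_sound {g : ℕ → ℕ → Bool} (a : ℕ → Bool) {rows : List (List ℕ × ℕ × ℕ)} :
    ∀ {k m c s : ℕ}, cutSearch g rows k m c s = true → RowsLt (rows.map Prod.fst) k →
      (∀ j < k, m / 2 ^ j % 2 = (a j).toNat) → m < 2 ^ k →
      5 ≤ c + rowsCost a rows k ∨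
        g (c + rowsCost a rows k) (s + rowsSize a rows.length k) = true := by
  induction rows with
  | nil =>
    intro k m c s h _ _ _
    simpa [cutSearch, rowsCost, rowsSize] using h
  | cons r rs ih =>
    intro k m c s h hlt ha hm
    rw [cutSearch, Bool.or_eq_true, Nat.ble_eq, Bool.and_eq_true] at h
    rcases h with h | ⟨h1, h2⟩
    · exact Or.inl (h.trans (Nat.le_add_right _ _))
    rw [List.map_cons, RowsLt] at hlt
    rw [rowsCost, List.length_cons, rowsSize, rowCost]
    have hj : ∀ j ∈ r.1, m / 2 ^ j % 2 = (a j).toNat := fun j hj => ha j (hlt.1 j hj)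
    cases hk : a k with
    | true =>
      have h3 := ih h1 hlt.2 (fun j hjk => by
        rw [← one_mul (2 ^ k)]
        rcases Nat.lt_succ_iff_lt_or_eq.1 hjk with hjk | rfl
        · rw [digit_add_lt hjk, ha j hjk]
        · rw [digit_add_self hm (by norm_num), hk]; rfl) (by
        rw [← one_mul (2 ^ k)]
        exact add_mul_pow_lt hm (by norm_num))
      have h4 : (r.1.map fun j => 1 - m / 2 ^ j % 2).sum =
          (r.1.map fun j => (a j ^^ true).toNat).sum := by
        congr 1
        refine List.map_congr_left fun j hjr => ?_
        rw [hj j hjr]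
        cases a j <;> rfl
      rw [h4] at h3
      simpa [add_assoc, add_comm, add_left_comm] using h3
    | false =>
      have h3 := ih h2 hlt.2 (fun j hjk => by
        rcases Nat.lt_succ_iff_lt_or_eq.1 hjk with hjk | rfl
        · exact ha j hjk
        · rw [Nat.div_eq_of_lt hm, hk]; rfl) (hm.trans (by rw [pow_succ]; omega))
      have h4 : (r.1.map fun j => m / 2 ^ j % 2).sum =
          (r.1.map fun j => (a j ^^ false).toNat).sum := by
        congr 1
        refine List.map_congr_left fun j hjr => ?_
        rw [hj j hjr]
        cases a j <;> rfl
      rw [h4] at h3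
      simpa [add_assoc, add_comm, add_left_comm] using h3

theorem rowsCost_ofFn (a : ℕ → Bool) {n : ℕ} (f : Fin n → List ℕ × ℕ × ℕ) (k : ℕ) :
    rowsCost a (List.ofFn f) k = ∑ i : Fin n, rowCost a (k + i) (f i) := by
  induction n generalizing k with
  | zero => simp [rowsCost]
  | succ n ih =>
    rw [List.ofFn_succ, rowsCost, ih, Fin.sum_univ_succ]
    simp [add_assoc, add_comm 1]

theorem rowsSize_eq (a : ℕ → Bool) (n k : ℕ) :
    rowsSize a n k = ∑ i : Fin n, (a (k + i)).toNat := by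
  induction n generalizing k with
  | zero => simp [rowsSize]
  | succ n ih =>
    rw [rowsSize, ih, Fin.sum_univ_succ]
    simp [add_assoc, add_comm 1]

theorem sum_map_filter {α : Type} (l : List α) (p : α → Bool) (f : α → ℕ) :
    ((l.filter p).map f).sum = (l.map fun e => if p e then f e else 0).sum := by
  induction l with
  | nil => rfl
  | cons x l ih =>
    by_cases h : p x = true
    · simp [h, ih]
    · simp [h, ih]

/-- The rows of a multipole, with given contributions of the vertices. -/
def cutRows {n m : ℕ} (P : Pole (Fin n) (Fin m) ι) (c d : Fin n → ℕ) :
    List (List ℕ × ℕ × ℕ) :=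
  List.ofFn fun v => (((List.finRange m).filter fun e => decide (P.src e = v)).map
    fun e => (P.tgt e).val, c v, d v)

/-- A set of vertices, extended to the natural numbers. -/
def extendSet {n : ℕ} (b : Fin n → Bool) (j : ℕ) : Bool := if h : j < n then b ⟨j, h⟩ else false

theorem extendSet_val {n : ℕ} (b : Fin n → Bool) (i : Fin n) : extendSet b i.val = b i := by
  simp [extendSet]

/-- Every edge is charged once, in the row of its source. The concrete links orient their edges
towards the smaller vertex, so that the search already knows the other end. -/
theorem rowsCost_cutRows {n m : ℕ} (P : Pole (Fin n) (Fin m) ι) (c d : Fin n → ℕ)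
    (b : Fin n → Bool) :
    rowsCost (extendSet b) (P.cutRows c d) 0 = P.cut b + ∑ v, if b v then c v else d v := by
  rw [cutRows, rowsCost_ofFn]
  simp only [rowCost, zero_add, extendSet_val, List.map_map, sum_map_filter, Function.comp_def]
  rw [Finset.sum_add_distrib]
  congr 1
  simp only [← Fin.sum_univ_def, decide_eq_true_eq]
  rw [Finset.sum_comm, cut]
  refine Finset.sum_congr rfl fun e _ => ?_
  rw [Finset.sum_ite_eq]
  simp [Bool.xor_comm]

theorem cutSearch_cutRows {n m : ℕ} {P : Pole (Fin n) (Fin m) ι} {c d : Fin n → ℕ}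
    {g : ℕ → ℕ → Bool} {rows : List (List ℕ × ℕ × ℕ)} (hrows : P.cutRows c d = rows)
    (hlt : RowsLt (rows.map Prod.fst) 0) (h : cutSearch g rows 0 0 0 0 = true)
    (b : Fin n → Bool) :
    5 ≤ P.cut b + ∑ v, (if b v then c v else d v) ∨
      g (P.cut b + ∑ v, if b v then c v else d v) (size b) = true := by
  have h1 := cutSearch_sound (extendSet b) h hlt (fun j hj => absurd hj (Nat.not_lt_zero j))
    (by norm_num)
  have h2 : rowsSize (extendSet b) rows.length 0 = size b := by
    rw [← hrows, cutRows, List.length_ofFn, rowsSize_eq]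
    simp [extendSet_val, size]
  rwa [zero_add, zero_add, h2, ← hrows, rowsCost_cutRows] at h1

theorem sum_comp_eq {n : ℕ} [Fintype ι] (t : ι → Fin n) (b : Fin n → Bool) :
    ∑ i, (b (t i)).toNat = ∑ v, if b v then ∑ i, (if t i = v then 1 else 0) else 0 := by
  have h (i : ι) : (b (t i)).toNat = ∑ v, if t i = v then (b v).toNat else 0 := by
    rw [Finset.sum_ite_eq]; simp
  rw [Finset.sum_congr rfl fun i _ => h i, Finset.sum_comm]
  refine Finset.sum_congr rfl fun v _ => ?_
  cases b v
  · simp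
  · rfl

/-- The number of semiedges at a vertex. -/
def outCount {n : ℕ} [Fintype ι] (t : ι → Fin n) (v : Fin n) : ℕ := ∑ i, if t i = v then 1 else 0

theorem expand_of_cutSearch {n m : ℕ} [Fintype ι] {P : Pole (Fin n) (Fin m) ι}
    {rows : List (List ℕ × ℕ × ℕ)} (hrows : P.cutRows (outCount P.out) (fun _ => 0) = rows)
    (hlt : RowsLt (rows.map Prod.fst) 0)
    (h : cutSearch (fun c s => Nat.beq s 0 || Nat.ble (s + 2) c) rows 0 0 0 0 = true)
    (b : Fin n → Bool) (hb : 1 ≤ size b) : min 5 (size b + 2) ≤ P.boundary b := by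
  have h1 := cutSearch_cutRows hrows hlt h b
  rw [boundary, sum_comp_eq]
  rw [Bool.or_eq_true, Nat.beq_eq, Nat.ble_eq] at h1
  simp only [outCount] at h1
  omega

/-- A semiedge of the first kind costs 1 if its end is outside the set, one of the second kind if
its end is inside. The cost is thus that of a cut between the two families, and no exceptional set
is allowed. -/
theorem separated_of_cutSearch {n m : ℕ} [Fintype ι] [Fintype κ]
    {P : Pole (Fin n) (Fin m) (ι ⊕ κ)} {rows : List (List ℕ × ℕ × ℕ)}
    (hrows : P.cutRows (outCount (P.out ∘ Sum.inr)) (outCount (P.out ∘ Sum.inl)) = rows)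
    (hlt : RowsLt (rows.map Prod.fst) 0)
    (h : cutSearch (fun _ _ => false) rows 0 0 0 0 = true) (b : Fin n → Bool) :
    5 ≤ P.cut b + (∑ i, (!b (P.out (Sum.inl i))).toNat +
      ∑ k, (b (P.out (Sum.inr k))).toNat) := by
  have h1 := cutSearch_cutRows hrows hlt h b
  have h2 := sum_comp_eq (P.out ∘ Sum.inl) fun v => !b v
  have h3 := sum_comp_eq (P.out ∘ Sum.inr) b
  simp only [Function.comp_apply] at h2 h3
  rw [h2, h3, add_comm (∑ v, _), ← Finset.sum_add_distrib]
  simp only [Bool.false_eq_true, or_false] at h1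
  convert h1 using 3 with v
  cases b v <;> simp [outCount]

/-! ### A verified search through colourings -/

/-- Search through the assignments of three colours to the items of the rows, one item at a time,
where each item lists the earlier items of a different colour, and add up the values of `w`.
The digits of `m` encode the colours chosen so far. -/
def colourSearch (w : ℕ → ℕ) : List (List ℕ) → ℕ → ℕ → ℕ
  | [], _, m => w m
  | r :: rs, k, m =>
      (bif r.all fun j => !Nat.beq (m / 4 ^ j % 4) 0 then
        colourSearch w rs (k + 1) (m + 0 * 4 ^ k) else 0) +
      ((bif r.all fun j => !Nat.beq (m / 4 ^ j % 4) 1 then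
        colourSearch w rs (k + 1) (m + 1 * 4 ^ k) else 0) +
      (bif r.all fun j => !Nat.beq (m / 4 ^ j % 4) 2 then
        colourSearch w rs (k + 1) (m + 2 * 4 ^ k) else 0))

/-- The colours `c` satisfy the constraints in the rows. -/
def RowsValid (c : ℕ → Fin 3) : List (List ℕ) → ℕ → Prop
  | [], _ => True
  | r :: rs, k => (∀ j ∈ r, c j ≠ c k) ∧ RowsValid c rs (k + 1)

theorem rowsValid_iff (c : ℕ → Fin 3) (rows : List (List ℕ)) (k : ℕ) :
    RowsValid c rows k ↔ ∀ i, ∀ j ∈ rows.getD i [], c j ≠ c (k + i) := by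
  induction rows generalizing k with
  | nil => simp [RowsValid]
  | cons r rs ih =>
    rw [RowsValid, ih]
    constructor
    · rintro ⟨h1, h2⟩ (_ | i)
      · simpa using h1
      · simpa [add_assoc, add_comm 1] using h2 i
    · intro h
      refine ⟨by simpa using h 0, fun i => ?_⟩
      simpa [add_assoc, add_comm 1] using h (i + 1)

/-- The colours `c`, with the `n` colours from `p` on replaced by `x`. -/
def insertColours {n : ℕ} (c : ℕ → Fin 3) (p : ℕ) (x : Fin n → Fin 3) (j : ℕ) : Fin 3 :=
  if h : p ≤ j ∧ j - p < n then x ⟨j - p, h.2⟩ else c j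

theorem insertColours_of_lt {n : ℕ} (c : ℕ → Fin 3) {p j : ℕ} (x : Fin n → Fin 3) (h : j < p) :
    insertColours c p x j = c j := by
  rw [insertColours, dif_neg]
  omega

theorem insertColours_add {n : ℕ} (c : ℕ → Fin 3) (p : ℕ) (x : Fin n → Fin 3) (i : Fin n) :
    insertColours c p x (p + i) = x i := by
  rw [insertColours, dif_pos ⟨by omega, by omega⟩]
  congr
  omega

theorem insertColours_cons {n : ℕ} (c : ℕ → Fin 3) (p : ℕ) (y : Fin 3) (x : Fin n → Fin 3) :
    insertColours c p (Fin.cons y x : Fin (n + 1) → Fin 3) =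
      insertColours (Function.update c p y) (p + 1) x := by
  ext j
  rcases lt_trichotomy j p with h | rfl | h
  · rw [insertColours_of_lt _ _ h, insertColours_of_lt _ _ (by omega),
      Function.update_of_ne h.ne]
  · rw [insertColours_of_lt _ _ (Nat.lt_succ_self _), Function.update_self]
    simpa using congrArg Fin.val
      (insertColours_add c j (Fin.cons y x : Fin (n + 1) → Fin 3) (0 : Fin (n + 1)))
  · obtain ⟨i, rfl⟩ := Nat.exists_eq_add_of_lt h
    by_cases hi : i < n
    · have h1 := insertColours_add c p (Fin.cons y x : Fin (n + 1) → Fin 3) (Fin.succ ⟨i, hi⟩)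
      have h2 := insertColours_add (Function.update c p y) (p + 1) x ⟨i, hi⟩
      rw [Fin.cons_succ] at h1
      rw [show p + i + 1 = p + ((Fin.succ ⟨i, hi⟩ : Fin (n + 1)) : ℕ) from rfl, h1, ← h2]
      congr 2
      simp only [Fin.val_succ]
      omega
    · rw [insertColours, insertColours, dif_neg (by omega), dif_neg (by omega),
        Function.update_of_ne h.ne']

theorem sum_cons {n : ℕ} (f : (Fin (n + 1) → Fin 3) → ℕ) :
    ∑ x, f x = ∑ y, ∑ x : Fin n → Fin 3, f (Fin.cons y x : Fin (n + 1) → Fin 3) := by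
  rw [← Fintype.sum_prod_type']
  exact (Fintype.sum_equiv (Fin.consEquiv fun _ => Fin 3) _ _ fun _ => rfl).symm

open Classical in
theorem colourSearch_eq {u : (ℕ → ℕ) → ℕ} {K : ℕ}
    (hu : ∀ f g : ℕ → ℕ, (∀ j < K, f j = g j) → u f = u g) {rows : List (List ℕ)} :
    ∀ {n k m : ℕ} {c : ℕ → Fin 3}, rows.length = n → k + n = K → RowsLt rows k →
      (∀ j < k, m / 4 ^ j % 4 = (c j).val) → m < 4 ^ k →
      colourSearch (fun m => u fun j => m / 4 ^ j % 4) rows k m =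
        ∑ x : Fin n → Fin 3, if RowsValid (insertColours c k x) rows k then
          u (fun j => (insertColours c k x j).val) else 0 := by
  induction rows with
  | nil =>
    rintro n k m c rfl hK - hc hm
    rw [List.length_nil, add_zero] at hK
    subst hK
    have h (x : Fin ([] : List (List ℕ)).length → Fin 3) :
        u (fun j => (insertColours c k x j).val) = u fun j => m / 4 ^ j % 4 :=
      hu _ _ fun j hj => by rw [insertColours_of_lt c x hj, hc j hj]
    simp [colourSearch, RowsValid, h]
  | cons r rs ih =>
    rintro n k m c rfl hK hlt hc hm
    rw [List.length_cons] at hK ⊢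
    have step (y : Fin 3) :
        (bif r.all fun j => !Nat.beq (m / 4 ^ j % 4) y.val then
          colourSearch (fun m => u fun j => m / 4 ^ j % 4) rs (k + 1) (m + y.val * 4 ^ k) else 0) =
        ∑ x : Fin rs.length → Fin 3,
          if RowsValid (insertColours c k (Fin.cons y x : Fin (rs.length + 1) → Fin 3))
            (r :: rs) k then
          u (fun j => (insertColours c k (Fin.cons y x : Fin (rs.length + 1) → Fin 3) j).val)
          else 0 := by
      have hy : y.val < 4 := by omega
      rw [ih (c := Function.update c k y) rfl (by omega) hlt.2 (fun j hj => by
          rcases Nat.lt_succ_iff_lt_or_eq.1 hj with hj | rfl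
          · rw [digit_add_lt hj, hc j hj, Function.update_of_ne hj.ne]
          · rw [digit_add_self hm hy, Function.update_self]) (add_mul_pow_lt hm hy)]
      have h1 : (r.all fun j => !Nat.beq (m / 4 ^ j % 4) y.val) = true ↔ ∀ j ∈ r, c j ≠ y := by
        rw [List.all_eq_true]
        refine forall₂_congr fun j hj => ?_
        rw [hc j (hlt.1 j hj), Bool.not_eq_true', ← Bool.not_eq_true, Nat.beq_eq, Ne, Fin.ext_iff]
      have h2 (x : Fin rs.length → Fin 3) :
          RowsValid (insertColours c k (Fin.cons y x : Fin (rs.length + 1) → Fin 3)) (r :: rs) k ↔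
          (∀ j ∈ r, c j ≠ y) ∧ RowsValid (insertColours (Function.update c k y) (k + 1) x) rs
            (k + 1) := by
        rw [RowsValid, insertColours_cons, insertColours_of_lt _ _ (Nat.lt_succ_self k),
          Function.update_self]
        refine and_congr_left fun _ => forall₂_congr fun j hj => ?_
        have hjk := hlt.1 j hj
        rw [insertColours_of_lt _ _ (by omega), Function.update_of_ne hjk.ne]
      simp only [h2]
      by_cases h3 : ∀ j ∈ r, c j ≠ y
      · rw [h1.2 h3, cond_true]
        refine Finset.sum_congr rfl fun x _ => ?_
        rw [insertColours_cons, if_congr (and_iff_right h3) rfl rfl]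
      · rw [Bool.eq_false_iff.2 fun h => h3 (h1.1 h), cond_false]
        simp [h3]
    rw [sum_cons, Fin.sum_univ_three, ← step, ← step, ← step]
    exact (add_assoc _ _ _).symm

theorem rowsLt_getD {rows : List (List ℕ)} :
    ∀ {k : ℕ}, RowsLt rows k → ∀ i, ∀ j ∈ rows.getD i [], j < k + i := by
  induction rows with
  | nil => simp
  | cons r rs ih =>
    rintro k ⟨h1, h2⟩ (_ | i) j hj
    · exact h1 j (by simpa using hj)
    · have := ih h2 i j (by simpa using hj)
      omega

/-- Distinct edges or semiedges that share a vertex. -/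
def Conflict (P : Pole V E ι) (p q : E ⊕ ι) : Prop := p ≠ q ∧ ∃ v, P.Inc p v ∧ P.Inc q v

/-- The rows list the conflicts of a multipole whose edges and semiedges are numbered by `idx`,
up to those between the first `k`, of which there are none. -/
structure IsConflictRows (P : Pole V E ι) (idx : E ⊕ ι → ℕ) (rows : List (List ℕ)) (k : ℕ) :
    Prop where
  rowsLt : RowsLt rows k
  injective : Function.Injective idx
  surjective : ∀ j < k + rows.length, ∃ p, idx p = j
  mem_of_conflict : ∀ p q, P.Conflict p q → idx p < idx q →
    k ≤ idx q ∧ idx p ∈ rows.getD (idx q - k) []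
  conflict_of_mem : ∀ p q, k ≤ idx q → idx p ∈ rows.getD (idx q - k) [] → P.Conflict p q

theorem IsConflictRows.proper_iff {P : Pole V E ι} {idx : E ⊕ ι → ℕ} {rows : List (List ℕ)} {k : ℕ}
    (h : P.IsConflictRows idx rows k) (c : ℕ → Fin 3) :
    P.Proper (c ∘ idx) ↔ RowsValid c rows k := by
  rw [rowsValid_iff]
  constructor
  · intro hc i j hj hcj
    have hi : i < rows.length := by
      by_contra hi
      rw [List.getD_eq_default _ _ (not_lt.1 hi)] at hj
      simp at hj
    have hjk := rowsLt_getD h.rowsLt i j hj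
    obtain ⟨p, rfl⟩ := h.surjective j (by omega)
    obtain ⟨q, hq⟩ := h.surjective (k + i) (by omega)
    rw [← hq] at hcj
    obtain ⟨hne, v, hp, hq'⟩ := h.conflict_of_mem p q (by omega)
      (by rwa [hq, Nat.add_sub_cancel_left])
    exact hne (hc p q v hp hq' hcj)
  · intro hc p q v hp hq hcpq
    by_contra hne
    rcases lt_or_gt_of_ne (h.injective.ne hne) with hlt | hlt
    · obtain ⟨h1, h2⟩ := h.mem_of_conflict p q ⟨hne, v, hp, hq⟩ hlt
      have := hc _ _ h2
      rw [Nat.add_sub_cancel' h1] at this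
      exact this hcpq
    · obtain ⟨h1, h2⟩ := h.mem_of_conflict q p ⟨Ne.symm hne, v, hq, hp⟩ hlt
      have := hc _ _ h2
      rw [Nat.add_sub_cancel' h1] at this
      exact this hcpq.symm

open Classical in
theorem count_eq_sum [Fintype E] (P : Pole V E ι) (b : ι → Fin 3) :
    P.count b = ∑ φ : E → Fin 3, if P.Proper (Sum.elim φ b) then 1 else 0 := by
  rw [count, Nat.card_eq_fintype_card, Fintype.card_subtype, Finset.card_filter]

theorem count_eq_colourSearch [Fintype E] {k n : ℕ} {P : Pole V E (Fin k)} (σ : E ≃ Fin n)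
    {rows : List (List ℕ)} (hn : rows.length = n)
    (hrows : P.IsConflictRows (Sum.elim (fun e => k + (σ e).val) Fin.val) rows k)
    (b : Fin k → Fin 3) {m : ℕ} (hm : m < 4 ^ k)
    (hb : ∀ i : Fin k, m / 4 ^ i.val % 4 = (b i).val) :
    P.count b = colourSearch (fun _ => 1) rows k m := by
  classical
  let c : ℕ → Fin 3 := fun j => if h : j < k then b ⟨j, h⟩ else 0
  rw [colourSearch_eq (u := fun _ => 1) (K := k + n) (c := c) (fun _ _ _ => rfl) hn rfl
    hrows.rowsLt (fun j hj => by simp only [c, dif_pos hj]; exact hb ⟨j, hj⟩) hm, count_eq_sum]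
  refine Fintype.sum_equiv (σ.arrowCongr (Equiv.refl _)) _ _ fun φ => ?_
  refine if_congr ?_ rfl rfl
  rw [← hrows.proper_iff]
  refine iff_of_eq (congrArg P.Proper ?_)
  ext (e | i)
  · rw [Function.comp_apply, Sum.elim_inl, Sum.elim_inl, insertColours_add]
    simp
  · rw [Function.comp_apply, Sum.elim_inr, Sum.elim_inr, insertColours_of_lt _ _ i.2]
    simp [c]

/-- The condition of `pentagramWeight` at one rotation, for colours given as numbers. -/
def pentagramTest (x₀ x₁ x₂ x₃ x₄ : ℕ) : Bool :=
  Nat.beq x₁ x₃ && (Nat.beq x₃ x₄ && (!Nat.beq x₀ x₂ && (!Nat.beq x₀ x₁ && !Nat.beq x₂ x₁)))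

/-- `pentagramWeight` for colours that are given as numbers. -/
def natWeight (x₀ x₁ x₂ x₃ x₄ : ℕ) : ℕ :=
  bif pentagramTest x₀ x₁ x₂ x₃ x₄ || (pentagramTest x₁ x₂ x₃ x₄ x₀ ||
    (pentagramTest x₂ x₃ x₄ x₀ x₁ || (pentagramTest x₃ x₄ x₀ x₁ x₂ ||
    pentagramTest x₄ x₀ x₁ x₂ x₃))) then 1 else 0

theorem natWeight_eq (b : Fin 5 → Fin 3) :
    natWeight (b 0).val (b 1).val (b 2).val (b 3).val (b 4).val = pentagramWeight b := by
  have h : ∀ x₀ x₁ x₂ x₃ x₄ : Fin 3, natWeight x₀.val x₁.val x₂.val x₃.val x₄.val =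
      pentagramWeight ![x₀, x₁, x₂, x₃, x₄] := by decide +kernel
  rw [h]
  congr
  ext i
  fin_cases i <;> rfl

/-- The weight of the colours at the positions `s`. -/
def digitWeight (s : Fin 5 → ℕ) (f : ℕ → ℕ) : ℕ :=
  natWeight (f (s 0)) (f (s 1)) (f (s 2)) (f (s 3)) (f (s 4))

/-- The sum over `d` and the sum over edge colourings merge into one search in which the joined
semiedges are items like the edges. The prescribed outer semiedges come first, as the initial
digits. -/
theorem sum_weight_mul_count [Fintype F] {k n : ℕ} {Q : Pole W F (Fin 5 ⊕ Fin k)}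
    (σ : F ⊕ Fin 5 ≃ Fin n) {rows : List (List ℕ)} (hn : rows.length = n)
    (hrows : Q.IsConflictRows (Sum.elim (fun e => k + (σ (Sum.inl e)).val)
      (Sum.elim (fun i => k + (σ (Sum.inr i)).val) Fin.val)) rows k)
    (b : Fin k → Fin 3) {m : ℕ} (hm : m < 4 ^ k)
    (hb : ∀ i : Fin k, m / 4 ^ i.val % 4 = (b i).val) :
    ∑ d, pentagramWeight d * Q.count (Sum.elim d b) =
      colourSearch (fun m => digitWeight (fun i => k + (σ (Sum.inr i)).val)
        fun j => m / 4 ^ j % 4) rows k m := by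
  classical
  let c : ℕ → Fin 3 := fun j => if h : j < k then b ⟨j, h⟩ else 0
  rw [colourSearch_eq (K := k + n) (c := c) ?_ hn rfl hrows.rowsLt
    (fun j hj => by simp only [c, dif_pos hj]; exact hb ⟨j, hj⟩) hm]
  · simp only [count_eq_sum, Finset.mul_sum]
    rw [Finset.sum_comm, ← Fintype.sum_prod_type']
    refine Fintype.sum_equiv ((Equiv.sumArrowEquivProdArrow _ _ _).symm.trans
      (σ.arrowCongr (Equiv.refl _))) _ _ fun φ => ?_
    have h : insertColours c k (((Equiv.sumArrowEquivProdArrow _ _ _).symm.trans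
        (σ.arrowCongr (Equiv.refl _))) φ) ∘ (Sum.elim (fun e => k + (σ (Sum.inl e)).val)
        (Sum.elim (fun i => k + (σ (Sum.inr i)).val) Fin.val)) =
        Sum.elim φ.1 (Sum.elim φ.2 b) := by
      ext (e | i | i)
      · rw [Function.comp_apply, Sum.elim_inl, Sum.elim_inl, insertColours_add]
        simp [Equiv.sumArrowEquivProdArrow]
      · rw [Function.comp_apply, Sum.elim_inr, Sum.elim_inl, Sum.elim_inr, Sum.elim_inl,
          insertColours_add]
        simp [Equiv.sumArrowEquivProdArrow]
      · rw [Function.comp_apply, Sum.elim_inr, Sum.elim_inr, Sum.elim_inr, Sum.elim_inr,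
          insertColours_of_lt _ _ i.2]
        simp [c]
    have h' (i : Fin 5) : insertColours c k (((Equiv.sumArrowEquivProdArrow _ _ _).symm.trans
        (σ.arrowCongr (Equiv.refl _))) φ) (k + (σ (Sum.inr i)).val) = φ.2 i :=
      congrFun h (Sum.inr (Sum.inl i))
    have h'' : RowsValid (insertColours c k (((Equiv.sumArrowEquivProdArrow _ _ _).symm.trans
        (σ.arrowCongr (Equiv.refl _))) φ)) rows k ↔ Q.Proper (Sum.elim φ.1 (Sum.elim φ.2 b)) := by
      rw [← hrows.proper_iff, h]
    rw [digitWeight]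
    simp only [h', h'', natWeight_eq]
    rw [mul_ite, mul_one, mul_zero]
  · intro f g hfg
    simp only [digitWeight]
    rw [hfg _ (by omega), hfg _ (by omega), hfg _ (by omega), hfg _ (by omega), hfg _ (by omega)]

instance [DecidableEq V] (P : Pole V E ι) (p : E ⊕ ι) (v : V) : Decidable (P.Inc p v) :=
  match p with
  | Sum.inl e => inferInstanceAs (Decidable (P.src e = v ∨ P.tgt e = v))
  | Sum.inr i => inferInstanceAs (Decidable (P.out i = v))

instance [Fintype V] [DecidableEq V] [DecidableEq E] [DecidableEq ι] (P : Pole V E ι)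
    (p q : E ⊕ ι) : Decidable (P.Conflict p q) :=
  inferInstanceAs (Decidable (p ≠ q ∧ ∃ v, P.Inc p v ∧ P.Inc q v))

instance decidableRowsLt : (rows : List (List ℕ)) → (k : ℕ) → Decidable (RowsLt rows k)
  | [], _ => isTrue trivial
  | r :: rs, k =>
    have := decidableRowsLt rs (k + 1)
    inferInstanceAs (Decidable ((∀ j ∈ r, j < k) ∧ RowsLt rs (k + 1)))

/-- Colours of the semiedges, encoded as the digits of a number. -/
def encode (b : Fin 5 → Fin 3) : ℕ :=
  (b 0).val + (b 1).val * 4 + (b 2).val * 16 + (b 3).val * 64 + (b 4).val * 256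

theorem encode_lt (b : Fin 5 → Fin 3) : encode b < 4 ^ 5 := by
  unfold encode
  omega

theorem encode_digit (b : Fin 5 → Fin 3) (i : Fin 5) : encode b / 4 ^ i.val % 4 = (b i).val := by
  unfold encode
  fin_cases i <;> simp <;> omega

/-- An extension is unique: the edge between the two isolated colours takes the majority colour, and
the other four edges alternate. -/
theorem pentagram_isPentagram : pentagram.IsPentagram 1 where
  robust := pentagram_robust
  count_eq b := by
    rw [one_mul, ← natWeight_eq, count_eq_colourSearch (Equiv.refl (Fin 5))
      (rows := [[0, 3], [1, 3, 5], [1, 4, 6], [2, 4, 7], [2, 0, 5, 8]]) rfl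
      ⟨by decide, by unfold Function.Injective; decide, by decide, by decide, by decide⟩ b
      (encode_lt b) (encode_digit b), encode]
    generalize b 0 = b₀, b 1 = b₁, b 2 = b₂, b 3 = b₃, b 4 = b₄
    revert b₀ b₁ b₂ b₃ b₄
    decide +kernel


/-! ### The multipliers by 5 and by 7 -/

/-- A multipole with 16 vertices, obtained from a snark by removing two disjoint pentagons. -/
def fivefold : Pole (Fin 16) (Fin 19) (Fin 5 ⊕ Fin 5) where
  src := ![1, 3, 6, 12, 15, 15, 12, 14, 14, 13, 13, 11, 10, 9, 7, 10, 7, 8, 5]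
  tgt := ![0, 1, 0, 4, 12, 14, 11, 13, 10, 11, 7, 9, 9, 6, 6, 8, 5, 3, 2]
  out := Sum.elim ![8, 3, 2, 5, 4] ![0, 4, 1, 15, 2]

theorem fivefold_simple : fivefold.Simple :=
  ⟨by decide, by unfold Function.Injective; decide +kernel⟩

theorem fivefold_robust : fivefold.Robust Sum.inl 2 where
  simple := fivefold_simple
  injective := by unfold Function.Injective; decide
  degree := by decide +kernel
  expand := expand_of_cutSearch
    (rows := [([], 1, 0), ([0], 1, 0), ([], 2, 0), ([1], 1, 0), ([], 2, 0), ([2], 1, 0), ([0], 0, 0),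
      ([6, 5], 0, 0), ([3], 1, 0), ([6], 0, 0), ([9, 8], 0, 0), ([9], 0, 0), ([4, 11], 0, 0),
      ([11, 7], 0, 0), ([13, 10], 0, 0), ([12, 14], 1, 0)])
    (by decide +kernel) (by decide +kernel) (by decide +kernel)
  apart := by decide +kernel

theorem fivefold_separated (b : Fin 16 → Bool) :
    5 ≤ fivefold.cut b + (∑ i, (!b (fivefold.out (Sum.inl i))).toNat +
      ∑ k, (b (fivefold.out (Sum.inr k))).toNat) :=
  separated_of_cutSearch
    (rows := [([], 1, 0), ([0], 1, 0), ([], 1, 1), ([1], 0, 1), ([], 1, 1), ([2], 0, 1), ([0], 0, 0),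
      ([6, 5], 0, 0), ([3], 0, 1), ([6], 0, 0), ([9, 8], 0, 0), ([9], 0, 0), ([4, 11], 0, 0),
      ([11, 7], 0, 0), ([13, 10], 0, 0), ([12, 14], 1, 0)])
    (by decide +kernel) (by decide +kernel) (by decide +kernel) b

/-- An order in which the edges of `fivefold` and its first five semiedges are coloured. -/
def fivefoldPosition : Fin 19 ⊕ Fin 5 → Fin 24 :=
  Sum.elim ![0, 1, 2, 3, 5, 6, 7, 8, 9, 10, 11, 12, 13, 14, 15, 16, 17, 18, 21] ![20, 19, 22,
    23, 4]

theorem fivefoldPosition_bijective : Function.Bijective fivefoldPosition := by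
  rw [Fintype.bijective_iff_injective_and_card]
  refine ⟨?_, by simp⟩
  unfold Function.Injective
  decide +kernel

/-- The conflicts between the edges and semiedges of `fivefold`. -/
def fivefoldRows : List (List ℕ) :=
  [[0, 2], [2, 5], [0, 5], [1], [1, 8], [3, 8], [3, 10], [8, 10], [11], [11, 13], [12, 13],
    [13, 15], [12, 15], [14, 17], [7, 17, 18], [7, 16, 19], [14, 18], [16, 20], [6, 21], [6,
    23], [21, 23], [4, 22], [4, 26], [22, 26]]

theorem fivefold_isConflictRows : fivefold.IsConflictRows
    (Sum.elim (fun e => 5 + (fivefoldPosition (Sum.inl e)).val)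
      (Sum.elim (fun i => 5 + (fivefoldPosition (Sum.inr i)).val) Fin.val)) fivefoldRows 5 where
  rowsLt := by decide +kernel
  injective := by unfold Function.Injective; decide +kernel
  surjective := by decide +kernel
  mem_of_conflict := by decide +kernel
  conflict_of_mem := by decide +kernel

theorem fivefold_isMultiplier : fivefold.IsMultiplier 5 where
  robust := fivefold_robust
  separated := fivefold_separated
  injective := by unfold Function.Injective; decide
  apart := by decide +kernel
  sum_eq b := by
    -- The eigenvector identity with eigenvalue 5 becomes one search for each of the `3 ^ 5`
    -- colourings of the outer semiedges.
    rw [sum_weight_mul_count (Equiv.ofBijective _ fivefoldPosition_bijective)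
      (rows := fivefoldRows) rfl fivefold_isConflictRows b (encode_lt b) (encode_digit b), encode,
      ← natWeight_eq]
    generalize b 0 = b₀, b 1 = b₁, b 2 = b₂, b 3 = b₃, b 4 = b₄
    revert b₀ b₁ b₂ b₃ b₄
    decide +kernel

/-- A multipole with 18 vertices, obtained from a snark by removing two disjoint pentagons. -/
def sevenfold : Pole (Fin 18) (Fin 22) (Fin 5 ⊕ Fin 5) where
  src := ![1, 3, 9, 10, 10, 14, 11, 14, 15, 15, 16, 13, 13, 17, 17, 12, 16, 8, 7, 4, 5, 6]
  tgt := ![0, 0, 8, 9, 3, 3, 10, 12, 14, 11, 15, 11, 12, 13, 16, 7, 6, 7, 4, 2, 2, 5]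
  out := Sum.elim ![4, 8, 6, 5, 1] ![2, 17, 1, 9, 0]

theorem sevenfold_simple : sevenfold.Simple :=
  ⟨by decide, by unfold Function.Injective; decide +kernel⟩

theorem sevenfold_robust : sevenfold.Robust Sum.inl 2 where
  simple := sevenfold_simple
  injective := by unfold Function.Injective; decide
  degree := by decide +kernel
  expand := expand_of_cutSearch
    (rows := [([], 1, 0), ([0], 2, 0), ([], 1, 0), ([0], 0, 0), ([2], 1, 0), ([2], 1, 0), ([5], 1, 0),
      ([4], 0, 0), ([7], 1, 0), ([8], 1, 0), ([9, 3], 0, 0), ([10], 0, 0), ([7], 0, 0), ([11,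
      12], 0, 0), ([3, 12], 0, 0), ([14, 11], 0, 0), ([15, 6], 0, 0), ([13, 16], 1, 0)])
    (by decide +kernel) (by decide +kernel) (by decide +kernel)
  apart := by decide +kernel

theorem sevenfold_separated (b : Fin 18 → Bool) :
    5 ≤ sevenfold.cut b + (∑ i, (!b (sevenfold.out (Sum.inl i))).toNat +
      ∑ k, (b (sevenfold.out (Sum.inr k))).toNat) :=
  separated_of_cutSearch
    (rows := [([], 1, 0), ([0], 1, 1), ([], 1, 0), ([0], 0, 0), ([2], 0, 1), ([2], 0, 1), ([5], 0, 1),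
      ([4], 0, 0), ([7], 0, 1), ([8], 1, 0), ([9, 3], 0, 0), ([10], 0, 0), ([7], 0, 0), ([11,
      12], 0, 0), ([3, 12], 0, 0), ([14, 11], 0, 0), ([15, 6], 0, 0), ([13, 16], 1, 0)])
    (by decide +kernel) (by decide +kernel) (by decide +kernel) b

/-- An order in which the edges of `sevenfold` and its first five semiedges are coloured. -/
def sevenfoldPosition : Fin 22 ⊕ Fin 5 → Fin 27 :=
  Sum.elim ![0, 2, 3, 4, 5, 6, 7, 8, 9, 10, 11, 12, 13, 14, 15, 16, 17, 18, 20, 21, 22, 24]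
    ![23, 19, 25, 26, 1]

theorem sevenfoldPosition_bijective : Function.Bijective sevenfoldPosition := by
  rw [Fintype.bijective_iff_injective_and_card]
  refine ⟨?_, by simp⟩
  unfold Function.Injective
  decide +kernel

/-- The conflicts between the edges and semiedges of `sevenfold`. -/
def sevenfoldRows : List (List ℕ) :=
  [[2, 4], [2, 5], [4, 5], [3], [3, 8], [7, 9], [7, 10], [9, 10], [11], [11, 13], [12, 14],
    [14, 15], [12, 15], [13, 17], [1, 17, 18], [1, 16, 19], [13, 18], [16, 20], [8, 21], [8,
    23], [21, 23], [0, 25], [0, 26], [25, 26], [22, 27], [22, 29], [27, 29]]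

theorem sevenfold_isConflictRows : sevenfold.IsConflictRows
    (Sum.elim (fun e => 5 + (sevenfoldPosition (Sum.inl e)).val)
      (Sum.elim (fun i => 5 + (sevenfoldPosition (Sum.inr i)).val) Fin.val)) sevenfoldRows 5 where
  rowsLt := by decide +kernel
  injective := by unfold Function.Injective; decide +kernel
  surjective := by decide +kernel
  mem_of_conflict := by decide +kernel
  conflict_of_mem := by decide +kernel

theorem sevenfold_isMultiplier : sevenfold.IsMultiplier 7 where
  robust := sevenfold_robust
  separated := sevenfold_separated
  injective := by unfold Function.Injective; decide
  apart := by decide +kernel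
  sum_eq b := by
    rw [sum_weight_mul_count (Equiv.ofBijective _ sevenfoldPosition_bijective)
      (rows := sevenfoldRows) rfl sevenfold_isConflictRows b (encode_lt b) (encode_digit b), encode,
      ← natWeight_eq]
    generalize b 0 = b₀, b 1 = b₁, b 2 = b₂, b 3 = b₃, b 4 = b₄
    revert b₀ b₁ b₂ b₃ b₄
    decide +kernel

/-! ### The two closing counts and the chain of multipliers -/

/-- The Petersen graph has no 3-edge-colouring. -/
theorem sum_pentagon (b : Fin 0 → Fin 3) :
    ∑ d, pentagramWeight d * pentagon.count (Sum.elim d b) = 0 := by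
  rw [sum_weight_mul_count finSumFinEquiv (m := 0)
    (rows := [[], [0], [1], [2], [3, 0], [0, 4], [0, 1], [1, 2], [2, 3], [3, 4]]) rfl
    ⟨by decide, by unfold Function.Injective; decide, by decide, by decide +kernel,
      by decide +kernel⟩ b (by norm_num) (fun i => i.elim0)]
  decide +kernel

/-- The Petersen graph with an edge subtracted has 18 colourings; this is the normalising constant
in `psi`. -/
theorem sum_path (b : Fin 0 → Fin 3) :
    ∑ d, pentagramWeight d * path.count (Sum.elim d b) = 18 := by
  rw [sum_weight_mul_count finSumFinEquiv (m := 0)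
    (rows := [[], [0], [1], [0], [0, 3], [0, 1], [1, 2]]) rfl
    ⟨by decide, by unfold Function.Injective; decide, by decide, by decide +kernel,
      by decide +kernel⟩ b (by norm_num) (fun i => i.elim0)]
  decide +kernel

theorem exists_isPentagram (i j : ℕ) :
    ∃ (V E : Type) (_ : Fintype V) (_ : DecidableEq V) (_ : Fintype E) (P : Pole V E (Fin 5)),
      P.IsPentagram (5 ^ i * 7 ^ j) := by
  induction i with
  | zero =>
    induction j with
    | zero => exact ⟨_, _, _, _, _, _, pentagram_isPentagram⟩
    | succ j ih =>
      obtain ⟨V, E, _, _, _, P, hP⟩ := ih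
      have := hP.glue sevenfold_isMultiplier
      rw [mul_assoc, ← pow_succ] at this
      exact ⟨_, _, _, _, _, _, this⟩
  | succ i ih =>
    obtain ⟨V, E, _, _, _, P, hP⟩ := ih
    have := hP.glue fivefold_isMultiplier
    rw [mul_right_comm, ← pow_succ] at this
    exact ⟨_, _, _, _, _, _, this⟩

end Pole

theorem theorem5p5 (i j : ℕ) :
    ∃ (V : Type) (G : SimpleGraph V) (e : Sym2 V),
      G.IsSnark ∧ G.CyclicallyEdgeConnected 5 ∧ e ∈ G.edgeSet ∧
        G.psi e = 5 ^ i * 7 ^ j := by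
  obtain ⟨V, E, _, _, _, P, hP⟩ := Pole.exists_isPentagram i j
  obtain ⟨V, G, e, h1, h2, h3, h4⟩ := hP.exists_snark Pole.sum_pentagon Pole.sum_path
  refine ⟨V, G, e, h1, h2, h3, ?_⟩
  rw [h4]
  push_cast
  rfl
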